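/- **Theorem 3 (high-dimensional sparse linear classification with the hinge loss).** Let $(X,Y)$ be a random pair with law $\mathbb P$ on $\mathbb R^d\times\{-1,1\}$, and let $D_n=\{(X_i,Y_i)\}_{i\le n}$ be an i.i.d. sample from $\mathbb P$. Put $p(x)=\mathbb P(Y=1\mid X=x)$, $\eta^*(x)=\mathrm{sign}(p(x)-1/2)$ and $R^*_{0/1}=\mathbb P(Y\ne\eta^*(X))$, where $\mathrm{sign}$ takes values in $\{-1,1\}$ with $\mathrm{sign}(0)=1$. For $\theta\in\mathbb R^d$ let $R_{0/1}(\theta)$ be either $\mathbb P(Y\ne \mathrm{sign}(\theta^\top X))$ or $\mathbb P(Y\,\theta^\top X<0)$; the claims hold for both. Let $\phi(y,t)=(1-yt)_+$, $R^h(\theta)=\mathbb E\,\phi(Y,\theta^\top X)$ and $r^h_n(\theta)=\frac1n\sum_{i=1}^n\phi(Y_i,\theta^\top X_i)$. Let $C_1>0$ and let $\Theta=B_1(C_1)=\{\theta\in\mathbb R^d:\|\theta\|_1\le C_1\}$. Let $L,K,B,C_{\rm x}>0$ and assume: 1. $\mathbb E\|X\|_2\le C_{\rm x}$. 2. (Target.)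 $\theta^*\in\Theta$ minimizes $R^h$ over $\Theta$ and is ideal for the hinge loss: $R^h(\theta^*)\le\mathbb E\,\phi(Y,f(X))$ for every measurable $f:\mathbb R^d\to\mathbb R$. With $s^*=\|\theta^*\|_0$ the number of nonzero coordinates of $\theta^*$, $s^*<n<d$. 3. (Bounded and Lipschitz loss.) Almost surely, for all $\theta,\theta'\in\Theta$: $0\le \phi(Y,\theta^\top X)\le B$ and $|\phi(Y,\theta^\top X)-\phi(Y,\theta'^\top X)|\le L\|\theta-\theta'\|_2$. 4. (Bernstein condition.) $\|\theta-\theta^*\|_2^2\le K\,[R^h(\theta)-R^h(\theta^*)]$ for all $\theta\in\Theta$. 5. (Margin condition.) $\mathbb P\{0<|p(X)-1/2|<1/(2c)\}=0$ for some $c>0$. Let $\pi$ be the probability measure on $\Theta$ with Lebesgue density proportional to $\prod_{i=1}^d(\tau^2+\theta_i^2)^{-2}$ on $\Theta$ (the scaled Student prior with 3 degrees of freedom), where $C_1>2d\tau$ and either (a) $\tau=(C_{\rm x}\,n\sqrt d)^{-1}$ and $\|\theta^*\|_1\le C_1-2d\tau$, or (b) $\tau=(C_{\rm x}\,n\,d)^{-1}$.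 Let $\lambda=n/\max(2L^2K,B)$, let $\hat\rho^h_\lambda(d\theta)\propto\exp[-\lambda r^h_n(\theta)]\,\pi(d\theta)$ be the Gibbs posterior and $\hat\theta=\int\theta\,\hat\rho^h_\lambda(d\theta)$ its mean. Then $$\mathbb E\big[\mathbb E_{\theta\sim\hat\rho^h_\lambda}[R_{0/1}(\theta)]\big]-R^*_{0/1}\le C\,\frac{s^*\log(d/s^*)}{n}\qquad\text{and}\qquad \mathbb E\big[R_{0/1}(\hat\theta)\big]-R^*_{0/1}\le C\,\frac{s^*\log(d/s^*)}{n},$$ where $C>0$ depends only on $L,K,B,C_1,C_{\rm x}$ (and $s^*\log(d/s^*)$ is read as $0$ when $s^*=0$). -/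

import Mathlib

open MeasureTheory ProbabilityTheory

noncomputable section

namespace SparseClassification

/-- The space of covariates and of parameters, with the Euclidean norm. -/
abbrev Vec (d : ℕ) : Type := EuclideanSpace ℝ (Fin d)

/-- A labelled observation `(x, y)`; laws are required to charge only `y = 1` and `y = -1`. -/
abbrev Obs (d : ℕ) : Type := Vec d × ℝ

/-- The sign with values in `{-1, 1}`. -/
def sgn (t : ℝ) : ℝ := if 0 ≤ t then 1 else -1

/-- The number of nonzero coordinates. -/
def l0 {d : ℕ} (θ : Vec d) : ℕ := (Finset.univ.filter fun i => θ i ≠ 0).card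

/-- The `ℓ¹` norm. -/
def l1 {d : ℕ} (θ : Vec d) : ℝ := ∑ i, |θ i|

/-- The closed `ℓ¹` ball of radius `C₁`; this is the parameter set `Θ`. -/
def ballL1 (d : ℕ) (C₁ : ℝ) : Set (Vec d) := {θ | l1 θ ≤ C₁}

/-- The regression function `p(x) = P(Y = 1 | X = x)`. -/
def regression {d : ℕ} (P : Measure (Obs d)) [IsFiniteMeasure P] (x : Vec d) : ℝ :=
  (P.condKernel x).real {1}

/-- The Bayes classifier `sign (p(x) - 1/2)`. -/
def bayesClassifier {d : ℕ} (P : Measure (Obs d)) [IsFiniteMeasure P] (x : Vec d) : ℝ :=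
  sgn (regression P x - 1 / 2)

/-- The misclassification risk of the Bayes classifier. -/
def bayesRisk {d : ℕ} (P : Measure (Obs d)) [IsFiniteMeasure P] : ℝ :=
  P.real {z | z.2 ≠ bayesClassifier P z.1}

/-- The misclassification risk `P(Y ≠ sign ⟨θ, X⟩)` of the linear classifier of `θ`. -/
def misclassRisk {d : ℕ} (P : Measure (Obs d)) (θ : Vec d) : ℝ :=
  P.real {z | z.2 ≠ sgn (inner ℝ θ z.1)}

/-- The prediction risk `P(Y ⟨θ, X⟩ < 0)`, in which ties `⟨θ, X⟩ = 0` are not counted. -/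
def predictionRisk {d : ℕ} (P : Measure (Obs d)) (θ : Vec d) : ℝ :=
  P.real {z | z.2 * inner ℝ θ z.1 < 0}

/-- The hinge loss `(1 - y t)₊` of the score `t` for the label `y`. -/
def hinge (y t : ℝ) : ℝ := max (1 - y * t) 0

/-- The hinge risk of an arbitrary score function. -/
def scoreRisk {d : ℕ} (P : Measure (Obs d)) (f : Vec d → ℝ) : ℝ :=
  ∫ z, hinge z.2 (f z.1) ∂P

/-- The hinge risk of the linear score of `θ`. -/
def hingeRisk {d : ℕ} (P : Measure (Obs d)) (θ : Vec d) : ℝ :=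
  scoreRisk P fun x => inner ℝ θ x

/-- The empirical hinge risk on a sample. -/
def empHingeRisk {n d : ℕ} (D : Fin n → Obs d) (θ : Vec d) : ℝ :=
  (1 / (n : ℝ)) * ∑ i, hinge (D i).2 (inner ℝ θ (D i).1)

/-- `θs` is ideal for the hinge loss: no measurable score function has a smaller hinge risk. -/
def IsHingeBayes {d : ℕ} (P : Measure (Obs d)) (θs : Vec d) : Prop :=
  ∀ f : Vec d → ℝ, Measurable f → Integrable (fun z : Obs d => hinge z.2 (f z.1)) P →
    hingeRisk P θs ≤ scoreRisk P f

/-- The unnormalized density of the scaled Student prior with three degrees of freedom. -/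
def studentWeight {d : ℕ} (τ : ℝ) (θ : Vec d) : ℝ := ∏ i, ((τ ^ 2 + θ i ^ 2) ^ 2)⁻¹

/-- The scaled Student prior restricted to the `ℓ¹` ball and normalized. -/
def prior (d : ℕ) (C₁ τ : ℝ) : Measure (Vec d) :=
  (volume.restrict (ballL1 d C₁)).withDensity fun θ =>
    ENNReal.ofReal (studentWeight τ θ / ∫ t in ballL1 d C₁, studentWeight τ t)

/-- The Gibbs posterior: the probability measure with density proportional to
`exp (-lam * r(θ))` with respect to the prior, where `r` is the empirical hinge risk. -/
def gibbs {n d : ℕ} (C₁ τ lam : ℝ) (D : Fin n → Obs d) : Measure (Vec d) :=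
  (prior d C₁ τ).tilted fun θ => -lam * empHingeRisk D θ

/-- The mean of the Gibbs posterior. -/
def posteriorMean {n d : ℕ} (C₁ τ lam : ℝ) (D : Fin n → Obs d) : Vec d :=
  ∫ θ, θ ∂(gibbs C₁ τ lam D)

/-- The law of an i.i.d. sample of size `n`. -/
def sampleLaw {d : ℕ} (P : Measure (Obs d)) (n : ℕ) : Measure (Fin n → Obs d) :=
  Measure.pi fun _ => P

end SparseClassification

end

noncomputable section

namespace SparseClassification

variable {n d : ℕ}

/-! Near `θs` the excess classification risk is not merely small, it is nonpositive; only the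
posterior mass at a fixed distance from `θs` matters, and it is exponentially small in `n`.

For scores bounded by one the hinge risk is `1 - E[Y f(X)]`, so the clipped ideal score maximizes a
linear functional. If a classifier `g` agrees with the ideal sign wherever the ideal score is at
least `1/2` in absolute value, a small move of the clipped score away from `g` stays bounded by one;
it cannot raise the functional, so by linearity `g` is optimal too, hence Bayes
(`misclassRisk_le_bayesRisk`). The Lipschitz condition forces `‖X‖ ≤ L`
(`norm_le_of_hinge_lipschitz`), so every `θ` within `1/(2L)` of `θs` qualifies.

The posterior mass of `‖θ - θs‖ ≥ r` is a ratio (`exists_dominating_gibbs_farSet`). By the Bernstein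
condition its numerator has mean at most `exp(-n u r²/(2K))`; its denominator is at least `exp(-n u
L ε)` times the prior mass of a set within `ε` of `θs`. A vector of bounded `ℓ¹` norm lies within a
fixed distance of one with `k` nonzero coordinates, `k` independent of `n`, `d` and `l0 θs`, and the
heavy-tailed prior charges a neighbourhood of that vector by at least a constant times `d^(-8k)`.
For large `n` the excess risk is thus at most `M d^(8k) exp(-α n)`, up to a constant factor.

Combined with the trivial bound 1 this gives the rate (`exists_sparse_rate_const`): either `log d`
is of order at least `n`, and then so is `s log(d/s)`, or the bound is exponentially small while `s
log(d/s) ≥ 1/2`. -/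

/-! ### Hinge risk, classification and ideal scores -/

lemma measurable_sgn : Measurable sgn :=
  Measurable.ite measurableSet_Ici measurable_const measurable_const

lemma sgn_eq (t : ℝ) : sgn t = 1 ∨ sgn t = -1 := by
  unfold sgn; split_ifs <;> simp

lemma measurable_bayesClassifier (P : Measure (Obs d)) [IsFiniteMeasure P] :
    Measurable (bayesClassifier P) := by
  refine measurable_sgn.comp (Measurable.sub_const ?_ _)
  exact (P.condKernel.measurable_coe (measurableSet_singleton 1)).ennreal_toReal

lemma hinge_nonneg (y t : ℝ) : 0 ≤ hinge y t := le_max_right _ _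

lemma continuous_hinge_inner :
    Continuous fun q : Vec d × Obs d => hinge q.2.2 (inner ℝ q.1 q.2.1) := by
  unfold hinge; fun_prop

lemma predictionRisk_le_misclassRisk (P : Measure (Obs d)) [IsFiniteMeasure P] (θ : Vec d) :
    predictionRisk P θ ≤ misclassRisk P θ := by
  refine measureReal_mono fun z hz => ?_
  simp only [Set.mem_ofPred_eq] at hz ⊢
  intro h
  rw [h, sgn] at hz
  split_ifs at hz <;> linarith

lemma abs_le_one_of_label {y : ℝ} (hy : y = 1 ∨ y = -1) : |y| ≤ 1 := by
  rcases hy with rfl | rfl <;> simp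

/-- Correlation with the label of a score bounded by one is an integral of a bounded function. -/
lemma integrable_label_mul {P : Measure (Obs d)} [IsProbabilityMeasure P]
    (hlab : ∀ᵐ z ∂P, z.2 = 1 ∨ z.2 = -1) {f : Vec d → ℝ} (hf : Measurable f)
    (hf1 : ∀ᵐ z ∂P, |f z.1| ≤ 1) : Integrable (fun z : Obs d => z.2 * f z.1) P := by
  refine Integrable.of_bound (C := 1) (by fun_prop) ?_
  filter_upwards [hlab, hf1] with z hz h1
  rw [Real.norm_eq_abs, abs_mul]
  exact mul_le_one₀ (abs_le_one_of_label hz) (abs_nonneg _) h1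

lemma hinge_eq_of_abs_le {y t : ℝ} (hy : y = 1 ∨ y = -1) (ht : |t| ≤ 1) :
    hinge y t = 1 - y * t := by
  obtain ⟨h1, h2⟩ := abs_le.1 ht
  rw [hinge, max_eq_left]
  rcases hy with rfl | rfl <;> linarith

lemma ae_hinge_eq {P : Measure (Obs d)}
    (hlab : ∀ᵐ z ∂P, z.2 = 1 ∨ z.2 = -1) {f : Vec d → ℝ}
    (hf1 : ∀ᵐ z ∂P, |f z.1| ≤ 1) :
    (fun z : Obs d => hinge z.2 (f z.1)) =ᵐ[P] fun z => 1 - z.2 * f z.1 := by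
  filter_upwards [hlab, hf1] with z hz h1 using hinge_eq_of_abs_le hz h1

lemma scoreRisk_eq {P : Measure (Obs d)} [IsProbabilityMeasure P]
    (hlab : ∀ᵐ z ∂P, z.2 = 1 ∨ z.2 = -1) {f : Vec d → ℝ} (hf : Measurable f)
    (hf1 : ∀ᵐ z ∂P, |f z.1| ≤ 1) :
    scoreRisk P f = 1 - ∫ z, z.2 * f z.1 ∂P := by
  rw [scoreRisk, integral_congr_ae (ae_hinge_eq hlab hf1),
    integral_sub (integrable_const _) (integrable_label_mul hlab hf hf1)]
  simp

/-- The risk of a classifier is an affine function of its correlation with the label. -/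
lemma measureReal_ne_eq {P : Measure (Obs d)} [IsProbabilityMeasure P]
    (hlab : ∀ᵐ z ∂P, z.2 = 1 ∨ z.2 = -1) {g : Vec d → ℝ} (hg : Measurable g)
    (hg1 : ∀ x, g x = 1 ∨ g x = -1) :
    P.real {z | z.2 ≠ g z.1} = (1 - ∫ z, z.2 * g z.1 ∂P) / 2 := by
  have hgle : ∀ᵐ z ∂P, |g z.1| ≤ 1 := .of_forall fun z => abs_le_one_of_label (hg1 z.1)
  have hm : MeasurableSet {z : Obs d | z.2 ≠ g z.1} :=
    (measurableSet_eq_fun measurable_snd (hg.comp measurable_fst)).compl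
  rw [← integral_indicator_one hm]
  have : Set.indicator {z : Obs d | z.2 ≠ g z.1} (1 : Obs d → ℝ) =ᵐ[P]
      fun z => (1 - z.2 * g z.1) / 2 := by
    filter_upwards [hlab] with z hz
    simp only [Set.indicator_apply, Set.mem_ofPred_eq, Pi.one_apply]
    rcases hz with hz | hz <;> rcases hg1 z.1 with h | h <;> rw [hz, h] <;> norm_num
  rw [integral_congr_ae this, integral_div,
    integral_sub (integrable_const _) (integrable_label_mul hlab hg hgle)]
  simp

lemma one_sub_mul_clip_le_hinge {y : ℝ} (hy : y = 1 ∨ y = -1) (t : ℝ) :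
    1 - y * max (-1) (min 1 t) ≤ hinge y t := by
  unfold hinge
  rcases hy with rfl | rfl <;> grind

/-- A step of `1/4` is short enough: for `|t| < 1/2` the value is at most `5/8 + 1/4`, and otherwise
the clipped score and `g` have the same sign. -/
lemma abs_clip_sub_le {t g : ℝ} (hg : g = 1 ∨ g = -1) (h : 1 / 2 ≤ |t| → g = sgn t) :
    |max (-1) (min 1 t) - (g - max (-1) (min 1 t)) / 4| ≤ 1 := by
  unfold sgn at h
  rw [abs_le]
  by_cases ht : 1 / 2 ≤ |t|
  · have hg := h ht
    subst hg
    rw [le_abs] at ht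
    grind
  · rw [not_le, abs_lt] at ht
    rw [min_eq_right (by linarith), max_eq_right (by linarith)]
    rcases hg with rfl | rfl <;> constructor <;> linarith

/-- Under an ideal linear score, a linear classifier which agrees with it wherever the ideal score
is not small is a Bayes classifier. -/
lemma misclassRisk_le_bayesRisk {P : Measure (Obs d)} [IsProbabilityMeasure P] {θs θ : Vec d}
    (hlab : ∀ᵐ z ∂P, z.2 = 1 ∨ z.2 = -1)
    (hint : Integrable (fun z : Obs d => hinge z.2 (inner ℝ θs z.1)) P)
    (hbayes : IsHingeBayes P θs)
    (hag : ∀ᵐ z ∂P, 1 / 2 ≤ |inner ℝ θs z.1| → sgn (inner ℝ θ z.1) = sgn (inner ℝ θs z.1)) :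
    misclassRisk P θ ≤ bayesRisk P := by
  set c : Vec d → ℝ := fun x => max (-1) (min 1 (inner ℝ θs x)) with hc
  set g : Vec d → ℝ := fun x => sgn (inner ℝ θ x) with hg
  have hcm : Measurable c := by rw [hc]; fun_prop
  have hgm : Measurable g := measurable_sgn.comp (by fun_prop)
  have hc1 : ∀ x, |c x| ≤ 1 := fun x => abs_le.2
    ⟨le_max_left _ _, max_le (by norm_num) (min_le_left _ _)⟩
  -- Ideality compares `θs` with every such `f`, and clipping never increases the hinge loss.
  have hopt : ∀ f : Vec d → ℝ, Measurable f → (∀ᵐ z ∂P, |f z.1| ≤ 1) →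
      ∫ z, z.2 * f z.1 ∂P ≤ ∫ z, z.2 * c z.1 ∂P := by
    intro f hf hf1
    have h1 := hbayes f hf (((integrable_const (1 : ℝ)).sub
      (integrable_label_mul hlab hf hf1)).congr (ae_hinge_eq hlab hf1).symm)
    rw [scoreRisk_eq hlab hf hf1] at h1
    have h2 : scoreRisk P c ≤ hingeRisk P θs := by
      refine integral_mono_of_nonneg (.of_forall fun z => hinge_nonneg _ _) hint ?_
      filter_upwards [hlab] with z hz
      rw [hinge_eq_of_abs_le hz (hc1 _)]
      exact one_sub_mul_clip_le_hinge hz _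
    rw [scoreRisk_eq hlab hcm (.of_forall fun z => hc1 z.1)] at h2
    linarith
  have hg1 : ∀ x, g x = 1 ∨ g x = -1 := fun x => sgn_eq _
  have hgle : ∀ᵐ z ∂P, |g z.1| ≤ 1 := .of_forall fun z => abs_le_one_of_label (hg1 z.1)
  have hcle : ∀ᵐ z ∂P, |c z.1| ≤ 1 := .of_forall fun z => hc1 z.1
  have hb1 : ∀ x, bayesClassifier P x = 1 ∨ bayesClassifier P x = -1 := fun x => sgn_eq _
  have hbm := measurable_bayesClassifier P
  have hb := hopt _ hbm (.of_forall fun z => abs_le_one_of_label (hb1 z.1))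
  -- Moving away from `g` turns the optimality of `c` into a lower bound for the correlation of `g`.
  have hpert := hopt (fun x => c x - (g x - c x) / 4) (by fun_prop) (by
    filter_upwards [hag] with z hz
    exact abs_clip_sub_le (hg1 z.1) hz)
  have hcg : ∫ z, z.2 * c z.1 ∂P ≤ ∫ z, z.2 * g z.1 ∂P := by
    have : ∀ z : Obs d, z.2 * (c z.1 - (g z.1 - c z.1) / 4) =
        (5 / 4) * (z.2 * c z.1) - (1 / 4) * (z.2 * g z.1) := fun z => by ring
    simp only [this] at hpert
    rw [integral_sub ((integrable_label_mul hlab hcm hcle).const_mul _)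
      ((integrable_label_mul hlab hgm hgle).const_mul _), integral_const_mul,
      integral_const_mul] at hpert
    linarith
  have e1 : misclassRisk P θ = _ := measureReal_ne_eq hlab hgm hg1
  have e2 : bayesRisk P = _ := measureReal_ne_eq hlab hbm hb1
  rw [e1, e2]
  linarith

/-! ### Norms and boundedness of the covariates -/

lemma l1_smul (a : ℝ) (θ : Vec d) : l1 (a • θ) = |a| * l1 θ := by
  simp [l1, abs_mul, Finset.mul_sum]

lemma l1_nonneg (θ : Vec d) : 0 ≤ l1 θ := Finset.sum_nonneg fun _ _ => abs_nonneg _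

lemma l1_add_le (θ θ' : Vec d) : l1 (θ + θ') ≤ l1 θ + l1 θ' := by
  rw [l1, l1, l1, ← Finset.sum_add_distrib]
  exact Finset.sum_le_sum fun i _ => by simpa using abs_add_le (θ i) (θ' i)

lemma norm_sq_eq (θ : Vec d) : ‖θ‖ ^ 2 = ∑ i, θ i ^ 2 := by
  simp [EuclideanSpace.norm_sq_eq]

lemma norm_le_l1 (θ : Vec d) : ‖θ‖ ≤ l1 θ := by
  refine le_of_sq_le_sq ?_ (l1_nonneg θ)
  rw [norm_sq_eq, l1]
  simpa using Finset.sum_sq_le_sq_sum_of_nonneg (s := Finset.univ) (f := fun i => |θ i|)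
    fun i _ => abs_nonneg _

lemma l1_le_sqrt_mul_norm (θ : Vec d) : l1 θ ≤ √d * ‖θ‖ := by
  refine le_of_sq_le_sq ?_ (by positivity)
  rw [mul_pow, Real.sq_sqrt (by positivity), norm_sq_eq, l1]
  simpa using sq_sum_le_card_mul_sum_sq (s := Finset.univ) (f := fun i => |θ i|)

/-- A covariate for which the loss is Lipschitz near the origin is bounded. -/
lemma norm_le_of_hinge_lipschitz {C₁ L : ℝ} (hC₁ : 0 < C₁) (hL : 0 < L) {x : Vec d} {y : ℝ}
    (hy : y = 1 ∨ y = -1)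
    (h : ∀ θ ∈ ballL1 d C₁, ∀ θ' ∈ ballL1 d C₁,
      |hinge y (inner ℝ θ x) - hinge y (inner ℝ θ' x)| ≤ L * ‖θ - θ'‖) : ‖x‖ ≤ L := by
  by_contra! hlt
  have hx : 0 < ‖x‖ := hL.trans hlt
  have hl := l1_nonneg x
  -- For this `t` the point `(y * t) • x` lies in the parameter set and on the linear branch of the
  -- hinge: from the origin the loss drops by `t‖x‖²` over a distance `t‖x‖`.
  obtain ⟨t, ht, ht1, ht2⟩ : ∃ t : ℝ, 0 < t ∧ t * l1 x ≤ C₁ ∧ t * ‖x‖ ^ 2 ≤ 1 := by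
    refine ⟨min (C₁ / (l1 x + 1)) (1 / ‖x‖ ^ 2), by positivity, ?_, ?_⟩
    · calc _ ≤ C₁ / (l1 x + 1) * l1 x := by gcongr; exact min_le_left _ _
        _ ≤ C₁ := by
          rw [div_mul_eq_mul_div, div_le_iff₀ (by positivity)]
          nlinarith
    · calc _ ≤ 1 / ‖x‖ ^ 2 * ‖x‖ ^ 2 := by gcongr; exact min_le_right _ _
        _ = 1 := by field_simp
  have hyy : y * y = 1 := by rcases hy with rfl | rfl <;> norm_num
  have hya : |y| = 1 := by rcases hy with rfl | rfl <;> norm_num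
  have h1 := h 0 (by simp [ballL1, l1, hC₁.le]) ((y * t) • x) (by
    rw [ballL1, Set.mem_ofPred_eq, l1_smul, abs_mul, hya, one_mul, abs_of_pos ht]
    exact ht1)
  rw [inner_zero_left, inner_smul_left, real_inner_self_eq_norm_sq, zero_sub, norm_neg, norm_smul,
    Real.norm_eq_abs, abs_mul, hya, one_mul, abs_of_pos ht] at h1
  have e : y * ((starRingEnd ℝ) (y * t) * ‖x‖ ^ 2) = t * ‖x‖ ^ 2 := by
    simp only [conj_trivial]; linear_combination t * ‖x‖ ^ 2 * hyy
  rw [hinge, hinge, e, max_eq_left (by simp), max_eq_left (by linarith)] at h1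
  have h2 := (le_abs_self _).trans h1
  have : t * ‖x‖ * ‖x‖ ≤ t * ‖x‖ * L := by nlinarith
  exact absurd (le_of_mul_le_mul_left this (by positivity)) (not_le.2 hlt)

lemma sgn_eq_of_close {s t : ℝ} (hs : 1 / 2 ≤ |s|) (h : |t - s| < 1 / 2) : sgn t = sgn s := by
  obtain ⟨h1, h2⟩ := abs_lt.1 h
  rcases le_abs.1 hs with h3 | h3
  · rw [sgn, sgn, if_pos (by linarith), if_pos (by linarith)]
  · rw [sgn, sgn, if_neg (by linarith), if_neg (by linarith)]

lemma misclassRisk_le_one (P : Measure (Obs d)) [IsProbabilityMeasure P] (θ : Vec d) :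
    misclassRisk P θ ≤ 1 := measureReal_le_one

/-- Every parameter close to the ideal one yields a Bayes classifier. -/
lemma misclassRisk_le_bayesRisk_of_close {P : Measure (Obs d)} [IsProbabilityMeasure P]
    {θs θ : Vec d} {L : ℝ} (hL : 0 < L)
    (hlab : ∀ᵐ z ∂P, z.2 = 1 ∨ z.2 = -1) (hX : ∀ᵐ z ∂P, ‖z.1‖ ≤ L)
    (hint : Integrable (fun z : Obs d => hinge z.2 (inner ℝ θs z.1)) P)
    (hbayes : IsHingeBayes P θs) (hθ : ‖θ - θs‖ < 1 / (2 * L)) :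
    misclassRisk P θ ≤ bayesRisk P := by
  refine misclassRisk_le_bayesRisk hlab hint hbayes ?_
  filter_upwards [hX] with z hz hs
  refine sgn_eq_of_close hs ?_
  rw [← inner_sub_left]
  calc _ ≤ ‖θ - θs‖ * ‖z.1‖ := abs_real_inner_le_norm _ _
    _ ≤ ‖θ - θs‖ * L := by gcongr
    _ < 1 / (2 * L) * L := by gcongr
    _ = 1 / 2 := by field_simp

/-! ### The Student weight: variance and sparse translations -/

/-- One factor of the Student weight. -/
def studentFactor (τ x : ℝ) : ℝ := ((τ ^ 2 + x ^ 2) ^ 2)⁻¹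

lemma studentFactor_pos {τ : ℝ} (hτ : 0 < τ) (x : ℝ) : 0 < studentFactor τ x := by
  unfold studentFactor; positivity

lemma studentWeight_eq (τ : ℝ) (θ : Vec d) :
    studentWeight τ θ = ∏ i, studentFactor τ (θ i) := rfl

lemma studentWeight_pos {τ : ℝ} (hτ : 0 < τ) (θ : Vec d) : 0 < studentWeight τ θ :=
  Finset.prod_pos fun _ _ => studentFactor_pos hτ _

lemma continuous_studentFactor {τ : ℝ} (hτ : 0 < τ) : Continuous (studentFactor τ) := by
  unfold studentFactor
  exact Continuous.inv₀ (by fun_prop) fun x => by positivity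

lemma continuous_studentWeight {τ : ℝ} (hτ : 0 < τ) :
    Continuous (studentWeight τ : Vec d → ℝ) := by
  have := continuous_studentFactor hτ
  simp only [funext (studentWeight_eq (d := d) τ)]
  fun_prop

lemma integrable_inv_sq_add_sq {τ : ℝ} (hτ : 0 < τ) :
    Integrable fun x : ℝ => (τ ^ 2 + x ^ 2)⁻¹ := by
  refine ((integrable_inv_one_add_sq.comp_div hτ.ne').const_mul (τ ^ 2)⁻¹).congr
    (.of_forall fun x => ?_)
  simp only
  rw [← mul_inv]
  congr 1
  field_simp

lemma integrable_studentFactor {τ : ℝ} (hτ : 0 < τ) : Integrable (studentFactor τ) := by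
  refine ((integrable_inv_sq_add_sq hτ).const_mul (τ ^ 2)⁻¹).mono'
    (continuous_studentFactor hτ).aestronglyMeasurable (.of_forall fun x => ?_)
  rw [Real.norm_of_nonneg (studentFactor_pos hτ x).le, studentFactor, ← mul_inv]
  gcongr
  nlinarith [sq_nonneg x, sq_nonneg τ, mul_nonneg (sq_nonneg x) (sq_nonneg τ), sq_nonneg (x ^ 2)]

lemma integrable_sq_mul_studentFactor {τ : ℝ} (hτ : 0 < τ) :
    Integrable fun x => x ^ 2 * studentFactor τ x := by
  refine (integrable_inv_sq_add_sq hτ).mono'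
    ((continuous_pow 2).mul (continuous_studentFactor hτ)).aestronglyMeasurable
    (.of_forall fun x => ?_)
  have := studentFactor_pos hτ x
  rw [Real.norm_of_nonneg (by positivity), studentFactor, ← div_eq_mul_inv, inv_eq_one_div,
    div_le_div_iff₀ (by positivity) (by positivity)]
  nlinarith [sq_nonneg x, sq_nonneg τ, mul_nonneg (sq_nonneg x) (sq_nonneg τ), sq_nonneg (τ ^ 2)]

lemma tendsto_div_sq_add_sq_atTop {τ : ℝ} :
    Filter.Tendsto (fun x : ℝ => x / (τ ^ 2 + x ^ 2)) .atTop (nhds 0) := by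
  refine squeeze_zero' ?_ ?_ tendsto_inv_atTop_zero
  · filter_upwards [Filter.eventually_ge_atTop 0] with x hx
    positivity
  · filter_upwards [Filter.eventually_gt_atTop 0] with x hx
    rw [inv_eq_one_div, div_le_div_iff₀ (by positivity) hx]
    nlinarith [sq_nonneg τ]

/-- The Student density with three degrees of freedom and scale `τ` has variance `τ ^ 2`. -/
lemma integral_sq_mul_studentFactor {τ : ℝ} (hτ : 0 < τ) :
    ∫ x, x ^ 2 * studentFactor τ x = τ ^ 2 * ∫ x, studentFactor τ x := by
  -- The derivative of `x/(τ² + x²)` is `(τ² - x²)/(τ² + x²)²`, and the function vanishes at both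
  -- ends.
  have hd : ∀ x : ℝ, HasDerivAt (fun x : ℝ => x / (τ ^ 2 + x ^ 2))
      (τ ^ 2 * studentFactor τ x - x ^ 2 * studentFactor τ x) x := by
    intro x
    have hne : τ ^ 2 + x ^ 2 ≠ 0 := by positivity
    refine ((hasDerivAt_id' x).div ((hasDerivAt_pow 2 x).const_add (τ ^ 2)) hne).congr_deriv ?_
    rw [studentFactor]
    field_simp
    push_cast
    ring
  have htop : Filter.Tendsto (fun x : ℝ => x / (τ ^ 2 + x ^ 2)) .atTop (nhds 0) :=
    tendsto_div_sq_add_sq_atTop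
  have hbot : Filter.Tendsto (fun x : ℝ => x / (τ ^ 2 + x ^ 2)) .atBot (nhds 0) := by
    have := (htop.comp Filter.tendsto_neg_atBot_atTop).neg
    rw [neg_zero] at this
    refine this.congr fun x => ?_
    simp [neg_div]
  have h := integral_of_hasDerivAt_of_tendsto hd
    (((integrable_studentFactor hτ).const_mul _).sub (integrable_sq_mul_studentFactor hτ)) hbot htop
  rw [integral_sub ((integrable_studentFactor hτ).const_mul _)
    (integrable_sq_mul_studentFactor hτ), integral_const_mul] at h
  linarith

lemma integral_vec_prod (f : Fin d → ℝ → ℝ) :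
    ∫ θ : Vec d, ∏ i, f i (θ i) = ∏ i, ∫ x, f i x := by
  rw [← integral_fintype_prod_volume_eq_prod,
    ← (PiLp.volume_preserving_toLp (Fin d)).integral_comp
      (MeasurableEquiv.toLp 2 (Fin d → ℝ)).measurableEmbedding]

lemma integrable_vec_prod {f : Fin d → ℝ → ℝ} (hf : ∀ i, Integrable (f i)) :
    Integrable fun θ : Vec d => ∏ i, f i (θ i) := by
  rw [← (PiLp.volume_preserving_toLp (Fin d)).integrable_comp_emb
      (MeasurableEquiv.toLp 2 (Fin d → ℝ)).measurableEmbedding]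
  exact Integrable.fintype_prod hf

lemma integrable_studentWeight {τ : ℝ} (hτ : 0 < τ) :
    Integrable (studentWeight τ : Vec d → ℝ) :=
  integrable_vec_prod fun _ => integrable_studentFactor hτ

lemma integral_studentWeight_pos {τ : ℝ} (hτ : 0 < τ) :
    0 < ∫ θ : Vec d, studentWeight τ θ :=
  integral_pos_of_integrable_nonneg_nonzero (x := 0) (continuous_studentWeight hτ)
    (integrable_studentWeight hτ) (fun θ => (studentWeight_pos hτ θ).le)
    (studentWeight_pos hτ _).ne'

lemma coord_sq_mul_studentWeight_eq (τ : ℝ) (j : Fin d) (θ : Vec d) :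
    θ j ^ 2 * studentWeight τ θ =
      ∏ i, (if i = j then θ i ^ 2 * studentFactor τ (θ i) else studentFactor τ (θ i)) := by
  rw [studentWeight_eq, ← Finset.mul_prod_erase _ _ (Finset.mem_univ j),
    ← Finset.mul_prod_erase _ _ (Finset.mem_univ j), if_pos rfl, ← mul_assoc]
  congr 1
  exact Finset.prod_congr rfl fun i hi => by rw [if_neg (Finset.ne_of_mem_erase hi)]

lemma integrable_coord_sq_mul_studentWeight {τ : ℝ} (hτ : 0 < τ) (j : Fin d) :
    Integrable fun θ : Vec d => θ j ^ 2 * studentWeight τ θ := by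
  simp only [coord_sq_mul_studentWeight_eq]
  refine integrable_vec_prod
    (f := fun i x => if i = j then x ^ 2 * studentFactor τ x else studentFactor τ x) fun i => ?_
  by_cases h : i = j
  · simpa only [h, if_true] using integrable_sq_mul_studentFactor hτ
  · simpa only [h, if_false] using integrable_studentFactor hτ

lemma integral_coord_sq_mul_studentWeight {τ : ℝ} (hτ : 0 < τ) (j : Fin d) :
    ∫ θ : Vec d, θ j ^ 2 * studentWeight τ θ = τ ^ 2 * ∫ θ : Vec d, studentWeight τ θ := by
  simp only [coord_sq_mul_studentWeight_eq]
  simp only [studentWeight_eq]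
  rw [integral_vec_prod
    (fun i x => if i = j then x ^ 2 * studentFactor τ x else studentFactor τ x),
    integral_vec_prod (fun _ x => studentFactor τ x),
    ← Finset.mul_prod_erase _ _ (Finset.mem_univ j),
    ← Finset.mul_prod_erase _ (fun _ => ∫ x, studentFactor τ x) (Finset.mem_univ j), ← mul_assoc]
  congr 1
  · simp only [if_true, integral_sq_mul_studentFactor hτ]
  · exact Finset.prod_congr rfl fun i hi => by simp only [Finset.ne_of_mem_erase hi, if_false]

/-- Three quarters of the Student mass lie within twice the standard deviation. -/
lemma setIntegral_closedBall_studentWeight_ge {τ : ℝ} (hτ : 0 < τ) (hd : 0 < d) :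
    3 / 4 * ∫ θ : Vec d, studentWeight τ θ ≤
      ∫ θ in Metric.closedBall (0 : Vec d) (2 * √d * τ), studentWeight τ θ := by
  have hd' : (0 : ℝ) < d := by exact_mod_cast hd
  set G := Metric.closedBall (0 : Vec d) (2 * √d * τ)
  have hG : MeasurableSet G := Metric.isClosed_closedBall.measurableSet
  have hW := integrable_studentWeight (d := d) hτ
  have hsq : ∀ θ : Vec d, ‖θ‖ ^ 2 * studentWeight τ θ = ∑ j, θ j ^ 2 * studentWeight τ θ :=
    fun θ => by rw [norm_sq_eq, Finset.sum_mul]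
  have hV : Integrable fun θ : Vec d => ‖θ‖ ^ 2 * studentWeight τ θ := by
    simp only [hsq]
    exact integrable_finsetSum _ fun j _ => integrable_coord_sq_mul_studentWeight hτ j
  have hVi : ∫ θ : Vec d, ‖θ‖ ^ 2 * studentWeight τ θ =
      d * (τ ^ 2 * ∫ θ : Vec d, studentWeight τ θ) := by
    simp only [hsq]
    rw [integral_finsetSum _ fun j _ => integrable_coord_sq_mul_studentWeight hτ j]
    simp [integral_coord_sq_mul_studentWeight hτ]
  -- Markov's inequality: the second moment is `dτ²` times the mass, the squared radius `4dτ²`.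
  have hmarkov : 4 * d * τ ^ 2 * ∫ θ in Gᶜ, studentWeight τ θ ≤
      ∫ θ : Vec d, ‖θ‖ ^ 2 * studentWeight τ θ := by
    rw [← integral_const_mul]
    refine le_trans (setIntegral_mono_on (hW.const_mul _).integrableOn hV.integrableOn hG.compl
      fun θ hθ => ?_) (setIntegral_le_integral hV (.of_forall fun θ => ?_))
    · have h1 : 2 * √d * τ ≤ ‖θ‖ := by
        have : ¬ dist θ 0 ≤ 2 * √d * τ := hθ
        rw [dist_zero_right] at this
        linarith
      have h2 : (2 * √d * τ) ^ 2 ≤ ‖θ‖ ^ 2 := by gcongr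
      rw [mul_pow, mul_pow, Real.sq_sqrt hd'.le] at h2
      exact mul_le_mul_of_nonneg_right (by linarith) (studentWeight_pos hτ θ).le
    · exact mul_nonneg (sq_nonneg _) (studentWeight_pos hτ θ).le
  rw [hVi] at hmarkov
  have h3 := integral_add_compl hG hW
  have h4 : ∫ θ in Gᶜ, studentWeight τ θ ≤ 1 / 4 * ∫ θ : Vec d, studentWeight τ θ := by
    refine le_of_mul_le_mul_left ?_ (show 0 < 4 * d * τ ^ 2 by positivity)
    linarith
  linarith

/-- From `(u + t)² ≤ 2u² + 2C²`. Polynomial tails make the cost of a translation polynomial in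
`C/τ`. -/
lemma studentFactor_add_ge {τ C : ℝ} (hτ : 0 < τ) {t : ℝ} (ht : |t| ≤ C) (u : ℝ) :
    ((2 + 2 * (C / τ) ^ 2) ^ 2)⁻¹ * studentFactor τ u ≤ studentFactor τ (u + t) := by
  rw [studentFactor, studentFactor, ← mul_inv, ← mul_pow]
  have h0 : 0 < τ ^ 2 + (u + t) ^ 2 := by positivity
  gcongr
  have h1 : t ^ 2 ≤ C ^ 2 := sq_le_sq' (by linarith [abs_le.1 ht]) (abs_le.1 ht).2
  have h2 : (2 + 2 * (C / τ) ^ 2) * (τ ^ 2 + u ^ 2) =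
      2 * τ ^ 2 + 2 * u ^ 2 + 2 * C ^ 2 + 2 * (C / τ) ^ 2 * u ^ 2 := by
    field_simp; ring
  rw [h2]
  nlinarith [sq_nonneg (u - t), mul_nonneg (sq_nonneg (C / τ)) (sq_nonneg u), sq_nonneg τ]

lemma abs_le_l1 (θ : Vec d) (i : Fin d) : |θ i| ≤ l1 θ :=
  Finset.single_le_sum (f := fun i => |θ i|) (fun _ _ => abs_nonneg _) (Finset.mem_univ i)

/-- Translating the Student weight by a sparse vector costs a factor for each nonzero coordinate. -/
lemma studentWeight_add_ge {τ C : ℝ} (hτ : 0 < τ) {v : Vec d} (hv : l1 v ≤ C) (u : Vec d) :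
    ((2 + 2 * (C / τ) ^ 2) ^ 2)⁻¹ ^ l0 v * studentWeight τ u ≤ studentWeight τ (u + v) := by
  rw [studentWeight_eq, studentWeight_eq, l0, ← Finset.prod_const, Finset.prod_filter,
    ← Finset.prod_mul_distrib]
  refine Finset.prod_le_prod (fun i _ => ?_) fun i _ => ?_
  · have := studentFactor_pos hτ (u i)
    split_ifs <;> positivity
  · split_ifs with h
    · exact studentFactor_add_ge hτ ((abs_le_l1 v i).trans hv) _
    · rw [not_not] at h
      simp [h]

/-- The ball is translated to the origin; only the nonzero coordinates of `v` pay, so the exponent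
is `k` and not `d`. -/
lemma setIntegral_closedBall_center_ge {τ C : ℝ} (hτ : 0 < τ) (hd : 0 < d) {v : Vec d}
    (hv : l1 v ≤ C) {k : ℕ} (hk : l0 v ≤ k) :
    3 / 4 * ((2 + 2 * (C / τ) ^ 2) ^ 2)⁻¹ ^ k * ∫ θ : Vec d, studentWeight τ θ ≤
      ∫ θ in Metric.closedBall v (2 * √d * τ), studentWeight τ θ := by
  set q := ((2 + 2 * (C / τ) ^ 2) ^ 2)⁻¹ with hq
  have hq0 : 0 < q := by positivity
  have hq1 : q ≤ 1 := inv_le_one_of_one_le₀ (one_le_pow₀ (by nlinarith [sq_nonneg (C / τ)]))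
  have hW := integrable_studentWeight (d := d) hτ
  have hI := integral_studentWeight_pos (d := d) hτ
  have e : ∫ θ in Metric.closedBall v (2 * √d * τ), studentWeight τ θ =
      ∫ u in Metric.closedBall (0 : Vec d) (2 * √d * τ), studentWeight τ (u + v) := by
    rw [← (measurePreserving_add_right volume v).setIntegral_preimage_emb
      (measurableEmbedding_addRight v)]
    congr 2
    ext u
    simp [dist_eq_norm]
  rw [e]
  calc _ = q ^ k * (3 / 4 * ∫ θ : Vec d, studentWeight τ θ) := by ring
    _ ≤ q ^ l0 v * ∫ u in Metric.closedBall (0 : Vec d) (2 * √d * τ), studentWeight τ u := by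
      refine mul_le_mul (pow_le_pow_of_le_one hq0.le hq1 hk)
        (setIntegral_closedBall_studentWeight_ge hτ hd) (by positivity) (by positivity)
    _ = ∫ u in Metric.closedBall (0 : Vec d) (2 * √d * τ), q ^ l0 v * studentWeight τ u :=
      (integral_const_mul _ _).symm
    _ ≤ _ := setIntegral_mono (hW.const_mul _).integrableOn (hW.comp_add_right v).integrableOn
      fun u => studentWeight_add_ge hτ hv u

/-! ### Prior mass near sparse vectors -/

lemma continuous_l1 : Continuous (l1 : Vec d → ℝ) := by unfold l1; fun_prop

lemma measurableSet_ballL1 (C₁ : ℝ) : MeasurableSet (ballL1 d C₁) :=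
  (isClosed_le continuous_l1 continuous_const).measurableSet

/-- Passing from the Euclidean to the `ℓ¹` norm costs `√d`, and `√d · 2√d τ = 2dτ`: this is the room
required around the center. -/
lemma closedBall_subset_ballL1 {C₁ τ : ℝ} {v : Vec d} (hv : l1 v + 2 * d * τ ≤ C₁) :
    Metric.closedBall v (2 * √d * τ) ⊆ ballL1 d C₁ := by
  intro θ hθ
  rw [Metric.mem_closedBall, dist_eq_norm] at hθ
  have h1 := l1_add_le v (θ - v)
  rw [add_sub_cancel] at h1
  have h2 := l1_le_sqrt_mul_norm (θ - v)
  have h3 : √d * ‖θ - v‖ ≤ √d * (2 * √d * τ) := by gcongr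
  have h4 : √d * (2 * √d * τ) = 2 * d * τ := by
    rw [show √d * (2 * √d * τ) = 2 * (√d * √d) * τ by ring, Real.mul_self_sqrt (by positivity)]
  exact (by linarith : l1 θ ≤ C₁)

lemma prior_apply {C₁ τ : ℝ} (hτ : 0 < τ) {S : Set (Vec d)} (hS : MeasurableSet S) :
    prior d C₁ τ S = ENNReal.ofReal ((∫ θ in S ∩ ballL1 d C₁, studentWeight τ θ) /
      ∫ θ in ballL1 d C₁, studentWeight τ θ) := by
  rw [prior, withDensity_apply _ hS, Measure.restrict_restrict hS,
    ← ofReal_integral_eq_lintegral_ofReal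
      ((integrable_studentWeight hτ).integrableOn.div_const _), integral_div]
  exact .of_forall fun θ => div_nonneg (studentWeight_pos hτ θ).le
    (integral_nonneg fun t => (studentWeight_pos hτ t).le)

lemma setIntegral_ballL1_pos {C₁ τ : ℝ} (hτ : 0 < τ) (hd : 0 < d) (hC : 2 * d * τ < C₁) :
    0 < ∫ θ in ballL1 d C₁, studentWeight τ θ := by
  have h0 : l1 (0 : Vec d) = 0 := by simp [l1]
  have hI := integral_studentWeight_pos (d := d) hτ
  calc (0 : ℝ) < 3 / 4 * ((2 + 2 * (0 / τ) ^ 2) ^ 2)⁻¹ ^ l0 (0 : Vec d) *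
        ∫ θ : Vec d, studentWeight τ θ := by positivity
    _ ≤ _ := setIntegral_closedBall_center_ge hτ hd h0.le le_rfl
    _ ≤ _ := setIntegral_mono_set (integrable_studentWeight hτ).integrableOn
      (.of_forall fun θ => (studentWeight_pos hτ θ).le)
      (closedBall_subset_ballL1 (by rw [h0]; linarith)).eventuallyLE

lemma isProbabilityMeasure_prior {C₁ τ : ℝ} (hτ : 0 < τ) (hd : 0 < d) (hC : 2 * d * τ < C₁) :
    IsProbabilityMeasure (prior d C₁ τ) := by
  constructor
  rw [prior_apply hτ .univ, Set.univ_inter, div_self (setIntegral_ballL1_pos hτ hd hC).ne',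
    ENNReal.ofReal_one]

lemma ae_prior_mem_ballL1 (C₁ τ : ℝ) : ∀ᵐ θ ∂prior d C₁ τ, θ ∈ ballL1 d C₁ :=
  (withDensity_absolutelyContinuous _ _).ae_le (ae_restrict_mem (measurableSet_ballL1 C₁))

/-- The prior charges neighbourhoods of sparse vectors polynomially in the scale. -/
lemma prior_closedBall_ge {C₁ τ : ℝ} (hτ : 0 < τ) (hd : 0 < d) (hC : 2 * d * τ < C₁)
    {v : Vec d} (hv : l1 v + 2 * d * τ ≤ C₁) {k : ℕ} (hk : l0 v ≤ k) :
    3 / 4 * ((2 + 2 * (C₁ / τ) ^ 2) ^ 2)⁻¹ ^ k ≤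
      (prior d C₁ τ).real (Metric.closedBall v (2 * √d * τ)) := by
  have hv1 : l1 v ≤ C₁ := by
    have : 0 ≤ 2 * d * τ := by positivity
    linarith
  have hZ := setIntegral_ballL1_pos hτ hd hC
  have hI := integral_studentWeight_pos (d := d) hτ
  -- Truncation lowers the normalizing constant, so it can only raise the mass of sets inside the
  -- ball.
  have hle : ∫ θ in ballL1 d C₁, studentWeight τ θ ≤ ∫ θ : Vec d, studentWeight τ θ :=
    setIntegral_le_integral (integrable_studentWeight hτ)
      (.of_forall fun θ => (studentWeight_pos hτ θ).le)
  rw [Measure.real, prior_apply hτ Metric.isClosed_closedBall.measurableSet,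
    Set.inter_eq_left.2 (closedBall_subset_ballL1 hv), ENNReal.toReal_ofReal
      (div_nonneg (integral_nonneg fun θ => (studentWeight_pos hτ θ).le) hZ.le), le_div_iff₀ hZ]
  exact le_trans (by gcongr) (setIntegral_closedBall_center_ge hτ hd hv1 hk)

/-- A vector of bounded `ℓ¹` norm is close to a vector with a bounded number of nonzero
coordinates. -/
lemma exists_sparse_approx {C h : ℝ} (hh : 0 < h) {v : Vec d} (hv : l1 v ≤ C) :
    ∃ v' : Vec d, l1 v' ≤ l1 v ∧ l0 v' ≤ ⌊C / h⌋₊ ∧ ‖v' - v‖ ^ 2 ≤ h * C := by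
  -- Hard thresholding: at most `C/h` coordinates exceed `h`, and the discarded ones satisfy `v_i² ≤
  -- h|v_i|`.
  refine ⟨WithLp.toLp 2 fun i => if h < |v i| then v i else 0, ?_, ?_, ?_⟩
  · refine Finset.sum_le_sum fun i _ => ?_
    simp only
    split_ifs <;> simp
  · refine Nat.le_floor ?_
    rw [le_div_iff₀ hh, l0]
    refine le_trans ?_ hv
    rw [← nsmul_eq_mul]
    refine (Finset.card_nsmul_le_sum _ (fun i => |v i|) h fun i hi => ?_).trans
      (Finset.sum_le_sum_of_subset_of_nonneg (Finset.subset_univ _) fun _ _ _ => abs_nonneg _)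
    have := (Finset.mem_filter.1 hi).2
    simp only [ne_eq, ite_eq_right_iff, Classical.not_imp] at this
    exact this.1.le
  · rw [norm_sq_eq]
    refine le_trans ?_ (mul_le_mul_of_nonneg_left hv hh.le)
    rw [l1, Finset.mul_sum]
    refine Finset.sum_le_sum fun i _ => ?_
    simp only [PiLp.sub_apply]
    split_ifs with hi
    · simpa using mul_nonneg hh.le (abs_nonneg (v i))
    · rw [zero_sub, neg_sq, ← sq_abs, sq]
      exact mul_le_mul_of_nonneg_right (not_lt.1 hi) (abs_nonneg _)

/-! ### Exponential moments of the empirical excess risk -/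

/-- A Bernstein-type bound: a bounded variable whose second moment is dominated by its mean has a
small Laplace transform. -/
lemma integral_exp_neg_mul_le {α : Type*} [MeasurableSpace α] {P : Measure α}
    [IsProbabilityMeasure P] {T : α → ℝ} (hT : AEStronglyMeasurable T P) {B V u : ℝ}
    (hB : ∀ᵐ z ∂P, |T z| ≤ B) (hV : ∀ᵐ z ∂P, T z ^ 2 ≤ V) (hu : 0 ≤ u) (huB : u * B ≤ 1)
    (huV : u * V ≤ (∫ z, T z ∂P) / 2) :
    ∫ z, Real.exp (-(u * T z)) ∂P ≤ Real.exp (-(u * ((∫ z, T z ∂P) / 2))) := by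
  have hTi : Integrable T P := Integrable.of_bound hT B hB
  -- By `exp(-x) ≤ 1 - x + x²` for `|x| ≤ 1`; half of the mean then absorbs the quadratic term.
  have h1 : ∫ z, Real.exp (-(u * T z)) ∂P ≤ ∫ z, (1 + u ^ 2 * V - u * T z) ∂P := by
    refine integral_mono_of_nonneg (.of_forall fun z => (Real.exp_pos _).le)
      ((integrable_const _).sub (hTi.const_mul u)) ?_
    filter_upwards [hB, hV] with z hz hz2
    have h2 : |-(u * T z)| ≤ 1 := by
      rw [abs_neg, abs_mul, abs_of_nonneg hu]
      exact (mul_le_mul_of_nonneg_left hz hu).trans huB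
    have h3 := (abs_le.1 (Real.abs_exp_sub_one_sub_id_le h2)).2
    have h4 : u ^ 2 * T z ^ 2 ≤ u ^ 2 * V := by gcongr
    nlinarith
  rw [integral_sub (integrable_const _) (hTi.const_mul u), integral_const_mul] at h1
  simp only [integral_const, probReal_univ, one_smul] at h1
  have h5 := Real.add_one_le_exp (-(u * ((∫ z, T z ∂P) / 2)))
  have h6 : u * (u * V) ≤ u * ((∫ z, T z ∂P) / 2) := by gcongr
  nlinarith

lemma continuous_empHingeRisk :
    Continuous fun q : (Fin n → Obs d) × Vec d => empHingeRisk q.1 q.2 := by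
  unfold empHingeRisk hinge; fun_prop

lemma empHingeRisk_nonneg (D : Fin n → Obs d) (θ : Vec d) : 0 ≤ empHingeRisk D θ :=
  mul_nonneg (by positivity) (Finset.sum_nonneg fun _ _ => hinge_nonneg _ _)

lemma ae_sampleLaw {P : Measure (Obs d)} [IsProbabilityMeasure P] {p : Obs d → Prop}
    (h : ∀ᵐ z ∂P, p z) : ∀ᵐ D ∂sampleLaw P n, ∀ i, p (D i) :=
  ae_all_iff.2 fun i => (Measure.quasiMeasurePreserving_eval (fun _ => P) i).ae h

instance (P : Measure (Obs d)) [IsProbabilityMeasure P] :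
    IsProbabilityMeasure (sampleLaw P n) := by
  unfold sampleLaw; infer_instance

lemma inv_mul_sum_le {f : Fin n → ℝ} {b : ℝ} (hb : 0 ≤ b) (hf : ∀ i, f i ≤ b) :
    1 / (n : ℝ) * ∑ i, f i ≤ b := by
  have h : ∑ i, f i ≤ n * b := by
    simpa using Finset.sum_le_card_nsmul Finset.univ f b fun i _ => hf i
  rcases Nat.eq_zero_or_pos n with rfl | hn
  · simpa using hb
  · have hn' : (0 : ℝ) < n := by exact_mod_cast hn
    rw [one_div, inv_mul_le_iff₀ hn']
    exact h

/-- The Laplace transform of the empirical excess risk is controlled by the excess risk. -/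
lemma integral_exp_empHingeRisk_le {P : Measure (Obs d)} [IsProbabilityMeasure P]
    {θs θ : Vec d} {L K B u : ℝ} (hK : 0 < K) (hn : 0 < n)
    (hBs : ∀ᵐ z ∂P, hinge z.2 (inner ℝ θs z.1) ≤ B)
    (hBθ : ∀ᵐ z ∂P, hinge z.2 (inner ℝ θ z.1) ≤ B)
    (hLip : ∀ᵐ z ∂P, |hinge z.2 (inner ℝ θ z.1) - hinge z.2 (inner ℝ θs z.1)| ≤ L * ‖θ - θs‖)
    (hBern : ‖θ - θs‖ ^ 2 ≤ K * (hingeRisk P θ - hingeRisk P θs))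
    (hu : 0 ≤ u) (huB : u * B ≤ 1) (huK : u * (2 * L ^ 2 * K) ≤ 1) :
    ∫ D, Real.exp (-(n * u) * (empHingeRisk D θ - empHingeRisk D θs)) ∂sampleLaw P n ≤
      Real.exp (-(n * u) * ((hingeRisk P θ - hingeRisk P θs) / 2)) := by
  have hn' : (n : ℝ) ≠ 0 := by exact_mod_cast hn.ne'
  set T : Obs d → ℝ := fun z => hinge z.2 (inner ℝ θ z.1) - hinge z.2 (inner ℝ θs z.1) with hT
  have hm : ∀ θ : Vec d, AEStronglyMeasurable (fun z : Obs d => hinge z.2 (inner ℝ θ z.1)) P :=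
    fun θ => (continuous_hinge_inner.comp
      (Continuous.prodMk_right θ)).aestronglyMeasurable
  have hI : ∀ θ : Vec d, (∀ᵐ z ∂P, hinge z.2 (inner ℝ θ z.1) ≤ B) →
      Integrable (fun z : Obs d => hinge z.2 (inner ℝ θ z.1)) P := fun θ h =>
    Integrable.of_bound (hm θ) B (by
      filter_upwards [h] with z hz
      rwa [Real.norm_of_nonneg (hinge_nonneg _ _)])
  have hTint : ∫ z, T z ∂P = hingeRisk P θ - hingeRisk P θs :=
    integral_sub (hI θ hBθ) (hI θs hBs)
  have hΔ : 0 ≤ hingeRisk P θ - hingeRisk P θs :=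
    nonneg_of_mul_nonneg_right ((sq_nonneg _).trans hBern) hK
  have key : ∫ z, Real.exp (-(u * T z)) ∂P ≤
      Real.exp (-(u * ((hingeRisk P θ - hingeRisk P θs) / 2))) := by
    rw [← hTint]
    refine integral_exp_neg_mul_le (T := T) (B := B) (V := L ^ 2 * ‖θ - θs‖ ^ 2) ((hm θ).sub (hm θs))
      ?_ ?_ hu huB ?_
    · filter_upwards [hBs, hBθ] with z h1 h2
      rw [abs_le]
      constructor <;> simp only [hT] <;>
        linarith [hinge_nonneg z.2 (inner ℝ θ z.1), hinge_nonneg z.2 (inner ℝ θs z.1)]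
    · filter_upwards [hLip] with z hz
      rw [← mul_pow, ← sq_abs]
      exact pow_le_pow_left₀ (abs_nonneg _) hz 2
    · rw [hTint]
      calc u * (L ^ 2 * ‖θ - θs‖ ^ 2)
          ≤ u * (L ^ 2 * (K * (hingeRisk P θ - hingeRisk P θs))) := by gcongr
        _ = u * (2 * L ^ 2 * K) * ((hingeRisk P θ - hingeRisk P θs) / 2) := by ring
        _ ≤ _ := mul_le_of_le_one_left (by positivity) huK
  have e : ∀ D : Fin n → Obs d,
      Real.exp (-(n * u) * (empHingeRisk D θ - empHingeRisk D θs)) =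
        ∏ i, Real.exp (-(u * T (D i))) := by
    intro D
    rw [← Real.exp_sum]
    congr 1
    simp only [empHingeRisk, hT, mul_sub, Finset.sum_neg_distrib, Finset.sum_sub_distrib,
      ← Finset.mul_sum]
    field_simp
    ring
  simp only [e]
  rw [sampleLaw, integral_fintype_prod_eq_pow (fun z => Real.exp (-(u * T z))), Fintype.card_fin]
  refine (pow_le_pow_left₀ (integral_nonneg fun z => (Real.exp_pos _).le) key n).trans_eq ?_
  rw [← Real.exp_nat_mul]
  congr 1
  ring

/-! ### Posterior mass far from the target -/

/-- Fubini for the integral of a nonnegative bounded function over a set of parameters. -/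
lemma integrable_and_integral_setIntegral_le {α β : Type*} [MeasurableSpace α]
    [MeasurableSpace β] {μ : Measure α} {ν : Measure β} [IsProbabilityMeasure μ]
    [IsProbabilityMeasure ν] {g : α × β → ℝ} (hg : Measurable g) (hg0 : ∀ q, 0 ≤ g q) {M κ : ℝ}
    (hM : ∀ᵐ a ∂μ, ∀ b, g (a, b) ≤ M) {S : Set β} (hS : MeasurableSet S)
    (hκ0 : 0 ≤ κ) (hκ : ∀ b ∈ S, ∫ a, g (a, b) ∂μ ≤ κ) :
    Integrable (fun a => ∫ b in S, g (a, b) ∂ν) μ ∧ ∫ a, ∫ b in S, g (a, b) ∂ν ∂μ ≤ κ := by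
  have hI : Integrable g (μ.prod (ν.restrict S)) := by
    refine Integrable.of_bound hg.aestronglyMeasurable M ?_
    filter_upwards [Measure.quasiMeasurePreserving_fst.ae hM] with q hq
    rw [Real.norm_of_nonneg (hg0 q)]
    exact hq q.2
  refine ⟨hI.integral_prod_left, ?_⟩
  rw [integral_integral_swap (f := fun a b => g (a, b)) hI]
  calc _ ≤ ∫ b in S, κ ∂ν := setIntegral_mono_on hI.integral_prod_right
        (integrable_const _).integrableOn hS hκ
    _ ≤ κ := by
      rw [setIntegral_const, smul_eq_mul]
      exact mul_le_of_le_one_left hκ0 measureReal_le_one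

lemma integrable_exp_gibbs {C₁ τ lam : ℝ} [IsProbabilityMeasure (prior d C₁ τ)] (hlam : 0 ≤ lam)
    (D : Fin n → Obs d) :
    Integrable (fun θ => Real.exp (-lam * empHingeRisk D θ)) (prior d C₁ τ) := by
  have hc : Continuous fun θ : Vec d => empHingeRisk D θ :=
    continuous_empHingeRisk.comp (Continuous.prodMk_right D)
  refine Integrable.of_bound (C := 1) (by fun_prop) (.of_forall fun θ => ?_)
  rw [Real.norm_of_nonneg (Real.exp_pos _).le, Real.exp_le_one_iff]
  nlinarith [mul_nonneg hlam (empHingeRisk_nonneg D θ)]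

lemma isProbabilityMeasure_gibbs {C₁ τ lam : ℝ} [IsProbabilityMeasure (prior d C₁ τ)]
    (hlam : 0 ≤ lam) (D : Fin n → Obs d) : IsProbabilityMeasure (gibbs C₁ τ lam D) :=
  isProbabilityMeasure_tilted (integrable_exp_gibbs hlam D)

lemma ae_gibbs_mem_ballL1 (C₁ τ lam : ℝ) (D : Fin n → Obs d) :
    ∀ᵐ θ ∂gibbs C₁ τ lam D, θ ∈ ballL1 d C₁ :=
  (tilted_absolutelyContinuous _ _).ae_le (ae_prior_mem_ballL1 C₁ τ)

/-- The posterior mass of a set, in terms of the prior mass of a neighbourhood of the target. -/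
lemma gibbs_real_le {C₁ τ lam L ε a : ℝ} [IsProbabilityMeasure (prior d C₁ τ)]
    (hlam : 0 ≤ lam) (hL : 0 ≤ L) (hε : 0 ≤ ε) {D : Fin n → Obs d} {θs : Vec d}
    (hLip : ∀ i, ∀ θ ∈ ballL1 d C₁,
      |hinge (D i).2 (inner ℝ θ (D i).1) - hinge (D i).2 (inner ℝ θs (D i).1)| ≤ L * ‖θ - θs‖)
    {A S : Set (Vec d)} (hA : MeasurableSet A) (hAC : A ⊆ ballL1 d C₁)
    (hAε : ∀ θ ∈ A, ‖θ - θs‖ ≤ ε) (ha : 0 < a) (haA : a ≤ (prior d C₁ τ).real A)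
    (hS : MeasurableSet S) :
    (gibbs C₁ τ lam D).real S ≤ Real.exp (lam * (L * ε)) / a *
      ∫ θ in S, Real.exp (-lam * (empHingeRisk D θ - empHingeRisk D θs)) ∂prior d C₁ τ := by
  have hI := integrable_exp_gibbs (C₁ := C₁) (τ := τ) hlam D
  -- The normalizing constant is bounded below by its part over `A`, where the empirical risk
  -- exceeds that of `θs` by at most `Lε`.
  have hZ : a * (Real.exp (-lam * empHingeRisk D θs) * Real.exp (-(lam * (L * ε)))) ≤
      ∫ θ, Real.exp (-lam * empHingeRisk D θ) ∂prior d C₁ τ := by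
    refine le_trans ?_ (setIntegral_le_integral (s := A) hI
      (.of_forall fun θ => (Real.exp_pos _).le))
    calc _ ≤ ∫ θ in A, Real.exp (-lam * empHingeRisk D θs) * Real.exp (-(lam * (L * ε)))
          ∂prior d C₁ τ := by
          rw [setIntegral_const, smul_eq_mul]
          gcongr
      _ ≤ _ := by
        refine setIntegral_mono_on (integrable_const _).integrableOn hI.integrableOn hA
          fun θ hθ => ?_
        rw [← Real.exp_add, Real.exp_le_exp]
        have h : empHingeRisk D θ - empHingeRisk D θs ≤ L * ε := by
          rw [empHingeRisk, empHingeRisk, ← mul_sub, ← Finset.sum_sub_distrib]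
          refine inv_mul_sum_le (by positivity) fun i => ?_
          exact (le_abs_self _).trans ((hLip i θ (hAC hθ)).trans (by gcongr; exact hAε θ hθ))
        nlinarith [mul_le_mul_of_nonneg_left h hlam]
  have hZ0 : 0 < ∫ θ, Real.exp (-lam * empHingeRisk D θ) ∂prior d C₁ τ :=
    lt_of_lt_of_le (by positivity) hZ
  have e : ∀ θ, Real.exp (-lam * (empHingeRisk D θ - empHingeRisk D θs)) =
      Real.exp (-lam * empHingeRisk D θ) * (Real.exp (-lam * empHingeRisk D θs))⁻¹ := fun θ => by
    rw [← Real.exp_neg, ← Real.exp_add]; congr 1; ring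
  have hN : 0 ≤ ∫ θ in S, Real.exp (-lam * empHingeRisk D θ) ∂prior d C₁ τ :=
    integral_nonneg fun θ => (Real.exp_pos _).le
  simp only [e]
  rw [integral_mul_const, gibbs, Measure.real, tilted_apply_eq_ofReal_integral' _ hS,
    integral_div, ENNReal.toReal_ofReal (div_nonneg hN hZ0.le), div_le_iff₀ hZ0]
  refine le_trans (le_of_eq ?_) (mul_le_mul_of_nonneg_left hZ (by positivity))
  rw [Real.exp_neg (lam * (L * ε))]
  field_simp

/-- The parameters at distance at least `r` from `θs`. -/
def farSet (d : ℕ) (C₁ r : ℝ) (θs : Vec d) : Set (Vec d) :=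
  {θ | θ ∈ ballL1 d C₁ ∧ r ≤ ‖θ - θs‖}

lemma measurableSet_farSet (C₁ r : ℝ) (θs : Vec d) : MeasurableSet (farSet d C₁ r θs) :=
  (measurableSet_ballL1 C₁).inter
    (isClosed_le continuous_const (by fun_prop : Continuous fun θ : Vec d => ‖θ - θs‖)).measurableSet

lemma norm_sub_le_of_mem_ballL1 {C₁ : ℝ} {θ θ' : Vec d} (h : θ ∈ ballL1 d C₁)
    (h' : θ' ∈ ballL1 d C₁) : ‖θ - θ'‖ ≤ 2 * C₁ := by
  have h1 : l1 θ ≤ C₁ := h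
  have h2 : l1 θ' ≤ C₁ := h'
  linarith [norm_sub_le θ θ', norm_le_l1 θ, norm_le_l1 θ']

/-- The posterior mass far from the target is dominated by a variable of exponentially small
mean. -/
lemma exists_dominating_gibbs_farSet {P : Measure (Obs d)} [IsProbabilityMeasure P]
    {θs : Vec d} {L K B C₁ τ u r ε a : ℝ} [IsProbabilityMeasure (prior d C₁ τ)]
    (hL : 0 ≤ L) (hK : 0 < K) (hn : 0 < n) (hθs : θs ∈ ballL1 d C₁)
    (hB : ∀ᵐ z ∂P, ∀ θ ∈ ballL1 d C₁, hinge z.2 (inner ℝ θ z.1) ≤ B)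
    (hLip : ∀ᵐ z ∂P, ∀ θ ∈ ballL1 d C₁, ∀ θ' ∈ ballL1 d C₁,
      |hinge z.2 (inner ℝ θ z.1) - hinge z.2 (inner ℝ θ' z.1)| ≤ L * ‖θ - θ'‖)
    (hBern : ∀ θ ∈ ballL1 d C₁, ‖θ - θs‖ ^ 2 ≤ K * (hingeRisk P θ - hingeRisk P θs))
    (hu : 0 ≤ u) (huB : u * B ≤ 1) (huK : u * (2 * L ^ 2 * K) ≤ 1) (hr : 0 ≤ r) (hε : 0 ≤ ε)
    {A : Set (Vec d)} (hA : MeasurableSet A) (hAC : A ⊆ ballL1 d C₁)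
    (hAε : ∀ θ ∈ A, ‖θ - θs‖ ≤ ε) (ha : 0 < a) (haA : a ≤ (prior d C₁ τ).real A) :
    ∃ G : (Fin n → Obs d) → ℝ, Integrable G (sampleLaw P n) ∧
      (∀ᵐ D ∂sampleLaw P n, (gibbs C₁ τ (n * u) D).real (farSet d C₁ r θs) ≤ G D) ∧
      ∫ D, G D ∂sampleLaw P n ≤ a⁻¹ * Real.exp (n * u * (L * ε - r ^ 2 / (2 * K))) := by
  have hS := measurableSet_farSet C₁ r θs
  have hlam : 0 ≤ n * u := by positivity
  have hF := integrable_and_integral_setIntegral_le (μ := sampleLaw P n) (ν := prior d C₁ τ)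
    (g := fun q => Real.exp (-(n * u) * (empHingeRisk q.1 q.2 - empHingeRisk q.1 θs)))
    (M := Real.exp (n * u * max B 0)) (κ := Real.exp (-(n * u) * (r ^ 2 / K / 2)))
    (by
      have h1 : Continuous fun q : (Fin n → Obs d) × Vec d => empHingeRisk q.1 q.2 :=
        continuous_empHingeRisk
      have h2 : Continuous fun q : (Fin n → Obs d) × Vec d => empHingeRisk q.1 θs :=
        continuous_empHingeRisk.comp (continuous_fst.prodMk continuous_const)
      exact Continuous.measurable (by fun_prop))
    (fun q => (Real.exp_pos _).le)
    (by
      filter_upwards [ae_sampleLaw hB] with D hD θ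
      rw [Real.exp_le_exp]
      have h1 : empHingeRisk D θs ≤ max B 0 :=
        inv_mul_sum_le (le_max_right _ _) fun i => (hD i θs hθs).trans (le_max_left _ _)
      nlinarith [mul_le_mul_of_nonneg_left h1 hlam, mul_nonneg hlam (empHingeRisk_nonneg D θ)])
    hS (Real.exp_pos _).le
    (by
      intro θ hθ
      refine (integral_exp_empHingeRisk_le hK hn (hB.mono fun z h => h θs hθs)
        (hB.mono fun z h => h θ hθ.1) (hLip.mono fun z h => h θ hθ.1 θs hθs) (hBern θ hθ.1)
        hu huB huK).trans ?_
      rw [Real.exp_le_exp, neg_mul, neg_mul, neg_le_neg_iff]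
      have h1 : r ^ 2 ≤ K * (hingeRisk P θ - hingeRisk P θs) :=
        (pow_le_pow_left₀ hr hθ.2 2).trans (hBern θ hθ.1)
      have h2 : r ^ 2 / K ≤ hingeRisk P θ - hingeRisk P θs := by
        rwa [div_le_iff₀ hK, mul_comm]
      gcongr)
  -- The dominating variable is the rescaled numerator, integrable by Fubini; measurability of the
  -- posterior in the sample is never needed.
  refine ⟨_, hF.1.const_mul (Real.exp (n * u * (L * ε)) / a), ?_, ?_⟩
  · filter_upwards [ae_sampleLaw hLip] with D hD
    exact gibbs_real_le hlam hL hε (fun i θ hθ => hD i θ hθ θs hθs) hA hAC hAε ha haA hS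
  · rw [integral_const_mul]
    refine (mul_le_mul_of_nonneg_left hF.2 (by positivity)).trans_eq ?_
    rw [div_eq_inv_mul, mul_assoc, ← Real.exp_add]
    congr 2
    field_simp
    ring

/-! ### From posterior mass to risk -/

/-- A risk which is small near the target has a mean controlled by the mass far from the target. -/
lemma integral_le_add_measureReal_farSet {R : Vec d → ℝ} {b : ℝ}
    (hR0 : ∀ θ, 0 ≤ R θ) (hR1 : ∀ θ, R θ ≤ 1) (hb : 0 ≤ b) {θs : Vec d} {C₁ r : ℝ} {ρ : Measure (Vec d)} [IsProbabilityMeasure ρ]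
    (hρ : ∀ᵐ θ ∂ρ, θ ∈ ballL1 d C₁)
    (hclose : ∀ θ : Vec d, ‖θ - θs‖ < r → R θ ≤ b) :
    ∫ θ, R θ ∂ρ ≤ b + ρ.real (farSet d C₁ r θs) := by
  have hS := measurableSet_farSet C₁ r θs
  have hind : Integrable ((farSet d C₁ r θs).indicator (1 : Vec d → ℝ)) ρ :=
    (integrable_const 1).indicator hS
  rw [← integral_indicator_one hS]
  refine (integral_mono_of_nonneg (.of_forall hR0)
    ((integrable_const (b)).add hind) ?_).trans_eq ?_
  · filter_upwards [hρ] with θ hθ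
    by_cases h : r ≤ ‖θ - θs‖
    · have : θ ∈ farSet d C₁ r θs := ⟨hθ, h⟩
      simp only [Pi.add_apply, Set.indicator_of_mem this, Pi.one_apply]
      exact (hR1 θ).trans (le_add_of_nonneg_left hb)
    · have : θ ∉ farSet d C₁ r θs := fun h' => h h'.2
      simp only [Pi.add_apply, Set.indicator_of_notMem this, add_zero]
      exact hclose θ (not_le.1 h)
  · rw [integral_add' (integrable_const _) hind]
    simp

/-- A risk which is small near the target is small at the mean of a measure with little mass far
from the target. -/
lemma apply_mean_le_add_measureReal_farSet {R : Vec d → ℝ} {b : ℝ}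
    (hR1 : ∀ θ, R θ ≤ 1) (hb : 0 ≤ b) {θs : Vec d} {C₁ r : ℝ} (hC₁ : 0 < C₁) (hr : 0 < r) (hθs : θs ∈ ballL1 d C₁)
    {ρ : Measure (Vec d)} [IsProbabilityMeasure ρ]
    (hρ : ∀ᵐ θ ∂ρ, θ ∈ ballL1 d C₁)
    (hclose : ∀ θ : Vec d, ‖θ - θs‖ < 2 * r → R θ ≤ b) :
    R (∫ θ, θ ∂ρ) ≤
      b + 2 * C₁ / r * ρ.real (farSet d C₁ r θs) := by
  have hS := measurableSet_farSet C₁ r θs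
  have hind : Integrable ((farSet d C₁ r θs).indicator (1 : Vec d → ℝ)) ρ :=
    (integrable_const 1).indicator hS
  by_cases h : ‖(∫ θ, θ ∂ρ) - θs‖ < 2 * r
  · exact (hclose _ h).trans (le_add_of_nonneg_right (by positivity))
  · have hid : Integrable (fun θ : Vec d => θ) ρ := by
      refine Integrable.of_bound (C := C₁) (by fun_prop) ?_
      filter_upwards [hρ] with θ hθ using (norm_le_l1 θ).trans hθ
    have h1 : (∫ θ, θ ∂ρ) - θs = ∫ θ, (θ - θs) ∂ρ := by
      rw [integral_sub hid (integrable_const _)]; simp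
    have h2 : ‖(∫ θ, θ ∂ρ) - θs‖ ≤ r + 2 * C₁ * ρ.real (farSet d C₁ r θs) := by
      rw [h1, ← integral_indicator_one hS]
      refine (norm_integral_le_integral_norm _).trans ((integral_mono_of_nonneg
        (.of_forall fun θ => norm_nonneg _)
        ((integrable_const r).add (hind.const_mul (2 * C₁))) ?_).trans_eq ?_)
      · filter_upwards [hρ] with θ hθ
        by_cases h : r ≤ ‖θ - θs‖
        · have : θ ∈ farSet d C₁ r θs := ⟨hθ, h⟩
          simp only [Pi.add_apply, Set.indicator_of_mem this, Pi.one_apply]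
          linarith [norm_sub_le_of_mem_ballL1 hθ hθs]
        · have : θ ∉ farSet d C₁ r θs := fun h' => h h'.2
          simp only [Pi.add_apply, Set.indicator_of_notMem this, mul_zero, add_zero]
          exact (not_le.1 h).le
      · rw [integral_add' (integrable_const _) (hind.const_mul _), integral_const_mul]
        simp
    -- A mean at distance `2r` or more forces far mass at least `r/(2C₁)`, and then the claimed
    -- bound exceeds 1.
    have h3 : 1 ≤ 2 * C₁ / r * ρ.real (farSet d C₁ r θs) := by
      rw [div_mul_eq_mul_div, le_div_iff₀ hr]
      linarith [not_lt.1 h]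
    linarith [hR1 (∫ θ, θ ∂ρ)]

/-! ### Sparse centers and the sparse rate -/

/-- Both prior scales allow a sparse center near the target whose neighbourhood stays in the
parameter set. -/
lemma exists_center {C₁ τ δ h : ℝ} (hC₁ : 0 < C₁) (hτ : 0 < τ) (hh : 0 < h)
    (hC : 2 * d * τ < C₁) {θs : Vec d} (hθs : l1 θs ≤ C₁)
    (hδ : 0 ≤ δ) (hcase : l1 θs ≤ C₁ - 2 * d * τ ∨ 2 * d * τ ≤ δ) :
    ∃ v : Vec d, l1 v + 2 * d * τ ≤ C₁ ∧ l0 v ≤ ⌊C₁ / h⌋₊ ∧ ‖v - θs‖ ≤ √(h * C₁) + δ := by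
  obtain ⟨w, hw1, hw2⟩ : ∃ w : Vec d, l1 w + 2 * d * τ ≤ C₁ ∧ ‖w - θs‖ ≤ δ := by
    rcases hcase with h1 | h1
    · exact ⟨θs, by linarith, by simpa using hδ⟩
    · have hdτ : 0 ≤ 2 * d * τ := by positivity
      have hq : 0 ≤ 1 - 2 * d * τ / C₁ := sub_nonneg.2 ((div_le_one hC₁).2 hC.le)
      -- Without room at the boundary, `θs` is shrunk towards the origin, which moves it by at most
      -- `2dτ`.
      refine ⟨(1 - 2 * d * τ / C₁) • θs, ?_, ?_⟩
      · rw [l1_smul, abs_of_nonneg hq]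
        have : (1 - 2 * d * τ / C₁) * l1 θs ≤ (1 - 2 * d * τ / C₁) * C₁ := by gcongr
        have e : (1 - 2 * d * τ / C₁) * C₁ = C₁ - 2 * d * τ := by field_simp
        linarith
      · have e : (1 - 2 * d * τ / C₁) • θs - θs = -((2 * d * τ / C₁) • θs) := by
          rw [sub_smul, one_smul]; abel
        rw [e, norm_neg, norm_smul, Real.norm_of_nonneg (by positivity)]
        calc 2 * d * τ / C₁ * ‖θs‖ ≤ 2 * d * τ / C₁ * C₁ := by
              gcongr; exact (norm_le_l1 θs).trans hθs
          _ = 2 * d * τ := by field_simp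
          _ ≤ δ := h1
  obtain ⟨v, hv1, hv2, hv3⟩ := exists_sparse_approx hh
    (show l1 w ≤ C₁ by linarith [show 0 ≤ 2 * d * τ by positivity])
  refine ⟨v, by linarith, hv2, ?_⟩
  have h1 : ‖v - w‖ ≤ √(h * C₁) := Real.le_sqrt_of_sq_le hv3
  linarith [norm_sub_le_norm_sub_add_norm_sub v w θs]

lemma half_le_mul_log_div {s d : ℕ} (hs : 1 ≤ s) (hsd : s < d) :
    1 / 2 ≤ s * Real.log (d / s) := by
  have hs' : (1 : ℝ) ≤ s := by exact_mod_cast hs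
  have hd' : (s : ℝ) + 1 ≤ d := by exact_mod_cast hsd
  have hd0 : (0 : ℝ) < d := by linarith
  have h1 := Real.one_sub_inv_le_log_of_pos (show (0 : ℝ) < d / s by positivity)
  rw [inv_div] at h1
  have h2 : s * (1 - (s : ℝ) / d) ≤ s * Real.log (d / s) := by gcongr
  have h3 : (1 : ℝ) / 2 ≤ s * (1 - (s : ℝ) / d) := by
    rw [show (s : ℝ) * (1 - s / d) = s * (d - s) / d by field_simp, le_div_iff₀ hd0]
    nlinarith
  linarith

/-- A quantity at most `1` and exponentially small in `n` up to a power of `d` obeys the sparse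
rate. -/
lemma exists_sparse_rate_const (M α : ℝ) (hM : 0 < M) (hα : 0 < α) (j n₀ : ℕ) :
    ∃ C : ℝ, 0 < C ∧ ∀ (n d s : ℕ) (x : ℝ), 1 ≤ s → s < n → n < d → x ≤ 1 →
      (n₀ ≤ n → x ≤ M * (d : ℝ) ^ j * Real.exp (-(α * n))) →
      x ≤ C * (s * Real.log (d / s) / n) := by
  -- With this `β`, `log d < βn` lets `d^j` consume at most half of the exponent `αn`.
  set β := α / (2 * (j + 1)) with hβ
  have hβ0 : 0 < β := by positivity
  obtain ⟨n₁, hn₁⟩ : ∃ n₁ : ℕ, ∀ n : ℕ, n₁ ≤ n → Real.log n ≤ β / 2 * n := by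
    have h := (Real.isLittleO_log_id_atTop.comp_tendsto
      (tendsto_natCast_atTop_atTop (R := ℝ))).bound (show 0 < β / 2 by positivity)
    obtain ⟨n₁, h⟩ := Filter.eventually_atTop.1 h
    refine ⟨n₁, fun n hn => ?_⟩
    have := h n hn
    simp only [Function.comp, id, Real.norm_natCast] at this
    exact (le_abs_self _).trans this
  refine ⟨2 * (n₀ + n₁) + 2 / β + 4 * M / α, by positivity, ?_⟩
  intro n d s x hs hsn hnd hx1 hx
  have hs' : (1 : ℝ) ≤ s := by exact_mod_cast hs
  have hn' : (0 : ℝ) < n := by exact_mod_cast (by omega : 0 < n)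
  have hd' : (0 : ℝ) < d := by exact_mod_cast (by omega : 0 < d)
  have hhalf := half_le_mul_log_div hs (hsn.trans hnd)
  rw [← mul_div_assoc, le_div_iff₀ hn']
  have t1 : (0 : ℝ) ≤ 2 * (n₀ + n₁) := by positivity
  have t2 : 0 ≤ 2 / β := by positivity
  have t3 : 0 ≤ 4 * M / α := by positivity
  set Λ := (s : ℝ) * Real.log (d / s) with hΛ
  have hΛ0 : 0 ≤ Λ := by linarith
  by_cases hsmall : n < n₀ + n₁
  · have h1 : (n : ℝ) ≤ n₀ + n₁ := by exact_mod_cast hsmall.le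
    have h2 : (n : ℝ) ≤ 2 * (n₀ + n₁) * Λ := by nlinarith
    nlinarith [mul_nonneg t2 hΛ0, mul_nonneg t3 hΛ0, mul_le_mul_of_nonneg_right hx1 hn'.le]
  · have hn0 : n₀ ≤ n := by omega
    have hlog := hn₁ n (by omega)
    -- If `log d ≥ βn`, then `log s ≤ log n ≤ βn/2` leaves `log(d/s) ≥ βn/2`, and the trivial bound
    -- suffices.
    by_cases hbig : β * n ≤ Real.log d
    · have h1 : Real.log s ≤ Real.log n :=
        Real.log_le_log (by linarith) (by exact_mod_cast hsn.le)
      have h2 : Real.log (d / s) = Real.log d - Real.log s :=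
        Real.log_div hd'.ne' (by linarith)
      have h3 : β / 2 * n ≤ Real.log (d / s) := by linarith
      have h4 : β / 2 * n ≤ Λ := by
        have : 0 ≤ β / 2 * n := by positivity
        nlinarith
      have h5 : (n : ℝ) ≤ 2 / β * Λ := by
        rw [div_mul_eq_mul_div, le_div_iff₀ hβ0]; linarith
      nlinarith [mul_nonneg t1 hΛ0, mul_nonneg t3 hΛ0, mul_le_mul_of_nonneg_right hx1 hn'.le]
    · have h1 : (d : ℝ) ^ j ≤ Real.exp (α / 2 * n) := by
        rw [← Real.exp_log hd', ← Real.exp_nat_mul, Real.exp_le_exp]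
        have h2 : β * (j + 1) = α / 2 := by rw [hβ]; field_simp
        have h3 : (j : ℝ) * Real.log d ≤ j * (β * n) := by gcongr; exact (not_le.1 hbig).le
        nlinarith [mul_pos hβ0 hn']
      have h4 : x ≤ M * Real.exp (-(α / 2 * n)) := by
        refine (hx hn0).trans ?_
        calc M * (d : ℝ) ^ j * Real.exp (-(α * n))
            ≤ M * Real.exp (α / 2 * n) * Real.exp (-(α * n)) := by gcongr
          _ = M * Real.exp (-(α / 2 * n)) := by
            rw [mul_assoc, ← Real.exp_add]; congr 2; ring
      have h5 : Real.exp (-(α / 2 * n)) * n ≤ 2 / α := by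
        rw [Real.exp_neg, inv_mul_le_iff₀ (Real.exp_pos _), mul_div_assoc', le_div_iff₀ hα]
        linarith [Real.add_one_le_exp (α / 2 * n)]
      have h6 : x * n ≤ 4 * M / α * Λ := by
        calc x * n ≤ M * Real.exp (-(α / 2 * n)) * n := by gcongr
          _ = M * (Real.exp (-(α / 2 * n)) * n) := by ring
          _ ≤ M * (2 / α) := by gcongr
          _ = 4 * M / α * (1 / 2) := by ring
          _ ≤ _ := by gcongr
      nlinarith [mul_nonneg t1 hΛ0, mul_nonneg t2 hΛ0]

/-- Only `G` has to be integrable: a nonnegative non-integrable `F` has integral zero by convention.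
-/
lemma integral_sub_le_of_le_add {P : Measure (Obs d)} [IsProbabilityMeasure P]
    {F G : (Fin n → Obs d) → ℝ} {b c : ℝ} (hF : ∀ D, 0 ≤ F D) (hG : Integrable G (sampleLaw P n))
    (h : ∀ᵐ D ∂sampleLaw P n, F D ≤ b + c * G D) :
    (∫ D, F D ∂sampleLaw P n) - b ≤ c * ∫ D, G D ∂sampleLaw P n := by
  have h1 := integral_mono_of_nonneg (.of_forall hF) ((integrable_const b).add (hG.const_mul c)) h
  rw [integral_add' (integrable_const _) (hG.const_mul _), integral_const_mul] at h1
  simp only [integral_const, probReal_univ, one_smul] at h1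
  linarith

lemma integral_sampleLaw_sub_le {P : Measure (Obs d)} [IsProbabilityMeasure P]
    {F : (Fin n → Obs d) → ℝ} {b c : ℝ} (hF : ∀ D, 0 ≤ F D) (h : ∀ D, F D ≤ b + c) :
    (∫ D, F D ∂sampleLaw P n) - b ≤ c := by
  have := integral_sub_le_of_le_add (P := P) (G := fun _ => 1) hF (integrable_const _)
    (.of_forall fun D => by simpa using h D)
  simpa using this

/-- Polynomial bound for the inverse of the prior mass of a neighbourhood of the target. -/
lemma inv_prior_mass_le {C₁ Cx τ : ℝ} (hC₁ : 0 < C₁) (hCx : 0 < Cx) (hτ : 0 < τ) {k : ℕ}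
    (hd : 1 ≤ d) (hnd : n ≤ d) (hτd : 1 / τ ≤ Cx * n * d) :
    (3 / 4 * ((2 + 2 * (C₁ / τ) ^ 2) ^ 2)⁻¹ ^ k)⁻¹ ≤
      4 / 3 * ((2 + 2 * (C₁ * Cx) ^ 2) ^ 2) ^ k * (d : ℝ) ^ (8 * k) := by
  have hd1 : (1 : ℝ) ≤ d := by exact_mod_cast hd
  have hnd' : (n : ℝ) ≤ d := by exact_mod_cast hnd
  -- As `n ≤ d`, `1/τ` is of order at most `d²`; a square, another square and the power `k` give
  -- `d^(8k)`.
  have h1 : C₁ / τ ≤ C₁ * Cx * d ^ 2 := by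
    calc C₁ / τ = C₁ * (1 / τ) := by ring
      _ ≤ C₁ * (Cx * d * d) := by
        gcongr
        exact hτd.trans (by gcongr)
      _ = _ := by ring
  have h2 : 2 + 2 * (C₁ / τ) ^ 2 ≤ (2 + 2 * (C₁ * Cx) ^ 2) * d ^ 4 := by
    have h3 : (C₁ / τ) ^ 2 ≤ (C₁ * Cx * d ^ 2) ^ 2 := by gcongr
    have h4 : (1 : ℝ) ≤ d ^ 4 := one_le_pow₀ hd1
    calc 2 + 2 * (C₁ / τ) ^ 2 ≤ 2 * (d : ℝ) ^ 4 + 2 * (C₁ * Cx * d ^ 2) ^ 2 := by linarith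
      _ = _ := by ring
  calc (3 / 4 * ((2 + 2 * (C₁ / τ) ^ 2) ^ 2)⁻¹ ^ k)⁻¹
      = 4 / 3 * ((2 + 2 * (C₁ / τ) ^ 2) ^ 2) ^ k := by
        rw [mul_inv, inv_pow, inv_inv]; norm_num
    _ ≤ 4 / 3 * (((2 + 2 * (C₁ * Cx) ^ 2) * d ^ 4) ^ 2) ^ k := by gcongr
    _ = _ := by rw [mul_pow, mul_pow, ← pow_mul, ← pow_mul]; ring

lemma eq_zero_of_l0_eq_zero {θ : Vec d} (h : l0 θ = 0) : θ = 0 := by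
  ext i
  have := Finset.card_eq_zero.1 h
  by_contra hi
  exact Finset.notMem_empty i (this ▸ Finset.mem_filter.2 ⟨Finset.mem_univ i, hi⟩)

end SparseClassification

end

/-! ### The main theorem -/

open SparseClassification in
theorem theorem3 (L K B C₁ Cx : ℝ) (hL : 0 < L) (hK : 0 < K) (hB : 0 < B) (hC₁ : 0 < C₁)
    (hCx : 0 < Cx) :
    ∃ C : ℝ, 0 < C ∧
      ∀ (n d : ℕ) (P : Measure (Obs d)) [IsProbabilityMeasure P] (θs : Vec d) (c τ lam : ℝ),
        -- labels, moment condition, high dimension and sparsity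
        (∀ᵐ z ∂P, z.2 = 1 ∨ z.2 = -1) →
        Integrable (fun z : Obs d => ‖z.1‖) P →
        (∫ z, ‖z.1‖ ∂P) ≤ Cx →
        n < d →
        l0 θs < n →
        -- the target parameter
        θs ∈ ballL1 d C₁ →
        IsMinOn (hingeRisk P) (ballL1 d C₁) θs →
        IsHingeBayes P θs →
        -- bounded loss
        (∀ᵐ z ∂P, ∀ θ ∈ ballL1 d C₁, hinge z.2 (inner ℝ θ z.1) ≤ B) →
        -- Lipschitz loss
        (∀ᵐ z ∂P, ∀ θ ∈ ballL1 d C₁, ∀ θ' ∈ ballL1 d C₁,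
          |hinge z.2 (inner ℝ θ z.1) - hinge z.2 (inner ℝ θ' z.1)| ≤ L * ‖θ - θ'‖) →
        -- Bernstein condition
        (∀ θ ∈ ballL1 d C₁, ‖θ - θs‖ ^ 2 ≤ K * (hingeRisk P θ - hingeRisk P θs)) →
        -- margin condition
        0 < c →
        P {z | 0 < |regression P z.1 - 1 / 2| ∧ |regression P z.1 - 1 / 2| < 1 / (2 * c)} = 0 →
        -- tuning parameters
        2 * d * τ < C₁ →
        ((τ = 1 / (Cx * n * √(d : ℝ)) ∧ l1 θs ≤ C₁ - 2 * d * τ) ∨ τ = 1 / (Cx * n * d)) →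
        lam = n / max (2 * L ^ 2 * K) B →
        -- the Gibbs posterior
        ((∫ D, (∫ θ, misclassRisk P θ ∂(gibbs C₁ τ lam D)) ∂(sampleLaw P n)) - bayesRisk P
            ≤ C * (l0 θs * Real.log (d / l0 θs) / n) ∧
          (∫ D, (∫ θ, predictionRisk P θ ∂(gibbs C₁ τ lam D)) ∂(sampleLaw P n)) - bayesRisk P
            ≤ C * (l0 θs * Real.log (d / l0 θs) / n)) ∧
        -- the posterior mean
        ((∫ D, misclassRisk P (posteriorMean C₁ τ lam D) ∂(sampleLaw P n)) - bayesRisk P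
            ≤ C * (l0 θs * Real.log (d / l0 θs) / n) ∧
          (∫ D, predictionRisk P (posteriorMean C₁ τ lam D) ∂(sampleLaw P n)) - bayesRisk P
            ≤ C * (l0 θs * Real.log (d / l0 θs) / n)) := by
  set u : ℝ := (max (2 * L ^ 2 * K) B)⁻¹ with hu_def
  have hmax : 0 < max (2 * L ^ 2 * K) B := lt_max_of_lt_right hB
  have hu : 0 < u := inv_pos.2 hmax
  have huB : u * B ≤ 1 := by
    rw [hu_def, inv_mul_le_iff₀ hmax, mul_one]; exact le_max_right _ _
  have huK : u * (2 * L ^ 2 * K) ≤ 1 := by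
    rw [hu_def, inv_mul_le_iff₀ hmax, mul_one]; exact le_max_left _ _
  -- Parameters within `2r = 1/(2L)` are Bayes; the factor two is slack for the posterior mean.
  set r : ℝ := 1 / (4 * L) with hr_def
  have hr : 0 < r := by positivity
  -- Makes `Lε = r²/(4K)`, half of the gain `r²/(2K)` in the exponent.
  set ε : ℝ := r ^ 2 / K / (4 * L) with hε_def
  have hε : 0 < ε := by positivity
  -- Makes the sparse approximation error `ε/2`.
  set h : ℝ := (ε / 2) ^ 2 / C₁ with hh_def
  have hh : 0 < h := by positivity
  have hhC : √(h * C₁) = ε / 2 := by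
    rw [hh_def, div_mul_cancel₀ _ hC₁.ne', Real.sqrt_sq (by positivity)]
  set k : ℕ := ⌊C₁ / h⌋₊
  set m : ℝ := 1 + 2 * C₁ / r
  have hm1 : 1 ≤ m := le_add_of_nonneg_right (by positivity)
  have hm2 : 2 * C₁ / r ≤ m := le_add_of_nonneg_left zero_le_one
  set M : ℝ := 4 / 3 * ((2 + 2 * (C₁ * Cx) ^ 2) ^ 2) ^ k
  have hM : 0 < M := by positivity
  set α : ℝ := u * (r ^ 2 / K / 4) with hα_def
  have hα : 0 < α := by positivity
  -- For `n ≥ n₀`, `2/(Cx n) ≤ ε/4`. This bounds both the shrinkage and the radius of the ball, for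
  -- a total of `ε/2 + ε/4 + ε/4`.
  set n₀ : ℕ := ⌈8 / (Cx * ε)⌉₊
  obtain ⟨C, hC, hrate⟩ := exists_sparse_rate_const (m * M) α (by positivity) hα (8 * k) n₀
  refine ⟨C, hC, ?_⟩
  intro n d P _ θs c τ lam hlab _ _ hnd hsn hθs _ hbayes hBd hLip hBern _ _ hdτ hcase hlam
  have hn : 0 < n := by omega
  have hd : 0 < d := by omega
  have hn' : (0 : ℝ) < n := by exact_mod_cast hn
  have hd' : (1 : ℝ) ≤ d := by exact_mod_cast hd
  have hsd : √(d : ℝ) ≤ d := Real.sqrt_le_iff.2 ⟨by linarith, by nlinarith⟩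
  have hτ : 0 < τ := by
    rcases hcase with ⟨h, -⟩ | h <;> rw [h] <;> positivity
  have hlam' : lam = n * u := by rw [hlam, hu_def, div_eq_mul_inv]
  have hlam0 : 0 ≤ lam := by rw [hlam']; positivity
  have hprior := isProbabilityMeasure_prior hτ hd hdτ
  have hgibbs : ∀ D : Fin n → Obs d, IsProbabilityMeasure (gibbs C₁ τ lam D) :=
    fun D => isProbabilityMeasure_gibbs hlam0 D
  have hint : Integrable (fun z : Obs d => hinge z.2 (inner ℝ θs z.1)) P := by
    refine Integrable.of_bound (continuous_hinge_inner.comp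
      (Continuous.prodMk_right θs)).aestronglyMeasurable B ?_
    filter_upwards [hBd] with z hz
    rw [Real.norm_of_nonneg (hinge_nonneg _ _)]
    exact hz θs hθs
  have hb : 0 ≤ bayesRisk P := measureReal_nonneg
  suffices hmain : ∀ R : Vec d → ℝ, (∀ θ, 0 ≤ R θ) → (∀ θ, R θ ≤ misclassRisk P θ) →
      (∫ D, (∫ θ, R θ ∂(gibbs C₁ τ lam D)) ∂(sampleLaw P n)) - bayesRisk P ≤
          C * (l0 θs * Real.log (d / l0 θs) / n) ∧
        (∫ D, R (posteriorMean C₁ τ lam D) ∂(sampleLaw P n)) - bayesRisk P ≤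
          C * (l0 θs * Real.log (d / l0 θs) / n) by
    obtain ⟨h1, h2⟩ := hmain _ (fun θ => measureReal_nonneg) fun θ => le_rfl
    obtain ⟨h3, h4⟩ := hmain _ (fun θ => measureReal_nonneg) (predictionRisk_le_misclassRisk P)
    exact ⟨⟨h1, h3⟩, h2, h4⟩
  intro R hR0 hRm
  have hR1 : ∀ θ, R θ ≤ 1 := fun θ => (hRm θ).trans (misclassRisk_le_one P θ)
  have hgR0 : ∀ D : Fin n → Obs d, 0 ≤ ∫ θ, R θ ∂(gibbs C₁ τ lam D) :=
    fun D => integral_nonneg hR0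
  have hgR : ∀ b : ℝ, (∀ θ, R θ ≤ b) → ∀ D : Fin n → Obs d,
      ∫ θ, R θ ∂(gibbs C₁ τ lam D) ≤ b := fun b hb D => by
    simpa using integral_mono_of_nonneg (μ := gibbs C₁ τ lam D) (.of_forall hR0)
      (integrable_const b) (.of_forall hb)
  rcases Nat.eq_zero_or_pos (l0 θs) with hs0 | hs
  -- The zero score never reaches `1/2`, so agreement with it is vacuous and every linear classifier
  -- is Bayes.
  · have hθ0 : θs = 0 := eq_zero_of_l0_eq_zero hs0
    have hall : ∀ θ, R θ ≤ bayesRisk P := fun θ =>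
      (hRm θ).trans (misclassRisk_le_bayesRisk hlab hint hbayes (.of_forall fun z hz => by
        rw [hθ0, inner_zero_left, abs_zero] at hz
        norm_num at hz))
    rw [hs0]
    simp only [Nat.cast_zero, zero_mul, zero_div, mul_zero]
    exact ⟨integral_sampleLaw_sub_le hgR0 fun D => by simpa using hgR _ hall D,
      integral_sampleLaw_sub_le (fun D => hR0 _) fun D => by simpa using hall _⟩
  have hX : ∀ᵐ z ∂P, ‖z.1‖ ≤ L := by
    filter_upwards [hlab, hLip] with z hz hz' using norm_le_of_hinge_lipschitz hC₁ hL hz hz'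
  have hclose : ∀ θ, ‖θ - θs‖ < 2 * r → R θ ≤ bayesRisk P := fun θ hθ =>
    (hRm θ).trans (misclassRisk_le_bayesRisk_of_close hL hlab hX hint hbayes
      (hθ.trans_eq (by rw [hr_def]; field_simp; norm_num)))
  have hdom : n₀ ≤ n → ∃ G : (Fin n → Obs d) → ℝ, Integrable G (sampleLaw P n) ∧
      (∀ᵐ D ∂sampleLaw P n, (gibbs C₁ τ lam D).real (farSet d C₁ r θs) ≤ G D) ∧
      m * ∫ D, G D ∂sampleLaw P n ≤ m * M * (d : ℝ) ^ (8 * k) * Real.exp (-(α * n)) := by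
    intro hn₀
    have hδ : 2 / (Cx * n) ≤ ε / 4 := by
      have h1 : 8 / (Cx * ε) ≤ n := (Nat.le_ceil _).trans (by exact_mod_cast hn₀)
      rw [div_le_iff₀ (by positivity)] at h1
      rw [div_le_iff₀ (by positivity)]
      linarith
    have hτs : √(d : ℝ) * τ ≤ 1 / (Cx * n) := by
      rcases hcase with ⟨h, -⟩ | h
      · rw [h]
        exact le_of_eq (by field_simp)
      · calc √(d : ℝ) * τ ≤ d * τ := by gcongr
          _ = 1 / (Cx * n) := by rw [h]; field_simp
    have hτinv : 1 / τ ≤ Cx * n * d := by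
      rcases hcase with ⟨h, -⟩ | h <;> rw [h, one_div_one_div]
      gcongr
    obtain ⟨v, hv1, hv2, hv3⟩ := exists_center (δ := 2 / (Cx * n)) hC₁ hτ hh hdτ hθs
      (by positivity) (hcase.imp And.right fun h => le_of_eq (by rw [h]; field_simp))
    obtain ⟨G, hG1, hG2, hG3⟩ := exists_dominating_gibbs_farSet (r := r) (ε := ε)
      hL.le hK hn hθs hBd hLip hBern hu.le huB huK hr.le hε.le
      Metric.isClosed_closedBall.measurableSet (closedBall_subset_ballL1 hv1)
      (fun θ hθ => by
        rw [Metric.mem_closedBall, dist_eq_norm] at hθ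
        have h1 := norm_sub_le_norm_sub_add_norm_sub θ v θs
        have h2 : 2 * √(d : ℝ) * τ ≤ 2 / (Cx * n) := by
          rw [mul_assoc, show 2 / (Cx * n) = 2 * (1 / (Cx * n)) by ring]
          gcongr
        rw [hhC] at hv3
        linarith)
      (by positivity) (prior_closedBall_ge hτ hd hdτ hv1 hv2)
    refine ⟨G, hG1, by rwa [hlam'], ?_⟩
    have e : n * u * (L * ε - r ^ 2 / (2 * K)) = -(α * n) := by
      rw [hα_def, hε_def]; field_simp; ring
    rw [e] at hG3
    rw [mul_assoc m M, mul_assoc m]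
    refine mul_le_mul_of_nonneg_left (hG3.trans ?_) (by positivity)
    exact mul_le_mul_of_nonneg_right (inv_prior_mass_le hC₁ hCx hτ hd hnd.le hτinv)
      (Real.exp_pos _).le
  constructor
  · refine hrate n d _ _ hs hsn hnd
      (integral_sampleLaw_sub_le hgR0 fun D => (hgR 1 hR1 D).trans (le_add_of_nonneg_left hb)) fun hn₀ => ?_
    obtain ⟨G, hG1, hG2, hG3⟩ := hdom hn₀
    refine (integral_sub_le_of_le_add hgR0 hG1 ?_).trans hG3
    filter_upwards [hG2] with D hD
    have h0 : 0 ≤ G D := measureReal_nonneg.trans hD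
    refine (integral_le_add_measureReal_farSet (r := r) hR0 hR1 hb (ae_gibbs_mem_ballL1 C₁ τ lam D)
      fun θ hθ => hclose θ (by linarith)).trans ?_
    nlinarith
  · refine hrate n d _ _ hs hsn hnd
      (integral_sampleLaw_sub_le (fun D => hR0 _) fun D => (hR1 _).trans (le_add_of_nonneg_left hb))
      fun hn₀ => ?_
    obtain ⟨G, hG1, hG2, hG3⟩ := hdom hn₀
    refine (integral_sub_le_of_le_add (fun D => hR0 _) hG1 ?_).trans hG3
    filter_upwards [hG2] with D hD
    refine (apply_mean_le_add_measureReal_farSet hR1 hb hC₁ hr hθs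
      (ae_gibbs_mem_ballL1 C₁ τ lam D) hclose).trans ?_
    gcongr
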